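/- Let $\mathcal X$ be a real separable Hilbert space. Write $L^+(\mathcal X)$ for the bounded self-adjoint non-negative operators on $\mathcal X$ and $L_1^+(\mathcal X)$ for the trace class ones among them. For $m\in\mathcal X$, $C\in L_1^+(\mathcal X)$ let $N_{m,C}$ be the Gaussian measure on $\mathcal X$ with mean $m$ and covariance operator $C$, and $N_C=N_{0,C}$; it is non-degenerate if $C$ is injective. For a self-adjoint trace class operator $A$ put $\det(I+A)=\prod_n(1+\lambda_n)$, where $\{\lambda_n\}$ are the eigenvalues of $A$ counted with multiplicity. The SE-$T$ kernel is $k_T(x,y)=e^{-\frac12\|Tx-Ty\|^2}$. For Borel probability measures $P,Q$ on $\mathcal X$ and $k=k_T$, let $z=(x,y)$ and $z'=(x',y')$ be independent with law $P\otimes Q$, and put $$h(z,z')=k(x,x')+k(y,y')-k(x,y')-k(x',y),\qquad \xi_1=\mathrm{Var}_z\big[\mathbb E_{z'}[h(z,z')]\big],\qquad \xi_2=\mathrm{Var}_{z,z'}[h(z,z')].$$ **(Mean shift.)** Let $P=N_S$, $Q=N_{m,S}$ be non-degenerate Gaussian measures, let $T\in L_1^+(\mathcal X)$, and assume that $T$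 and $S$ commute. Then, with $\Sigma=(I+TST)(I+3TST)$, $$\begin{aligned}\xi_1&=2\det(\Sigma)^{-\frac12}\big(1+e^{-\langle(I+3TST)^{-1}Tm,Tm\rangle}-2e^{-\frac12\langle(I+2TST)\Sigma^{-1}Tm,Tm\rangle}\big)\\&\quad-2\det(I+2TST)^{-1}\big(1+e^{-\langle(I+2TST)^{-1}Tm,Tm\rangle}-2e^{-\frac12\langle(I+2TST)^{-1}Tm,Tm\rangle}\big),\\ \xi_2&=2\det(I+4TST)^{-\frac12}\big(1+e^{-\langle(I+4TST)^{-1}Tm,Tm\rangle}\big)\\&\quad-2\det(I+2TST)^{-1}\big(1+e^{-\langle(I+2TST)^{-1}Tm,Tm\rangle}-4e^{-\frac12\langle(I+2TST)^{-1}Tm,Tm\rangle}\big)\\&\quad-8\det(\Sigma)^{-\frac12}e^{-\frac12\langle(I+2TST)\Sigma^{-1}Tm,Tm\rangle}.\end{aligned}$$ **(General form.)** Let $P=N_{a,S}$, $Q=N_{b,R}$ be non-degenerate Gaussian measures, let $T\in L^+(\mathcal X)$, and assume that $T,S,R$ commute pairwise. Then $$\xi_1=\alpha(T,S,R,a,b)+\alpha(T,R,S,a,b),\qquad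 \xi_2=\beta(T,S,R,a,b)+\beta(T,R,S,a,b),$$ where, with $d=T(a-b)$ and $\Sigma_{T,S,R}=(I+TST)(I+TRT)+TST(2I+T(S+R)T)$, $$\begin{aligned}\alpha(T,S,R,a,b)&=\det\big((I+TST)(I+3TST)\big)^{-\frac12}-\det(I+2TST)^{-1}\\ &\quad+\det\big((I+TRT)(I+T(2S+R)T)\big)^{-\frac12}e^{-\langle(I+T(2S+R)T)^{-1}d,d\rangle}\\ &\quad-\det(I+T(S+R)T)^{-1}e^{-\langle(I+T(S+R)T)^{-1}d,d\rangle}\\ &\quad-2\det(\Sigma_{T,S,R})^{-\frac12}e^{-\frac12\langle(I+2TST)\Sigma_{T,S,R}^{-1}d,d\rangle}\\ &\quad+2\det\big((I+2TST)(I+T(S+R)T)\big)^{-\frac12}e^{-\frac12\langle(I+T(S+R)T)^{-1}d,d\rangle},\\ \beta(T,S,R,a,b)&=\det(I+4TST)^{-\frac12}-\det(I+2TST)^{-1}\\ &\quad+\det(I+2T(S+R)T)^{-\frac12}e^{-\langle(I+2T(S+R)T)^{-1}d,d\rangle}\\ &\quad-\det(I+T(S+R)T)^{-1}e^{-\langle(I+T(S+R)T)^{-1}d,d\rangle}\\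 &\quad+4\det\big((I+T(S+R)T)(I+2TST)\big)^{-\frac12}e^{-\frac12\langle(I+T(S+R)T)^{-1}d,d\rangle}\\ &\quad-4\det(\Sigma_{T,S,R})^{-\frac12}e^{-\frac12\langle(I+2TST)\Sigma_{T,S,R}^{-1}d,d\rangle}.\end{aligned}$$ -/

import Mathlib

open MeasureTheory ProbabilityTheory

noncomputable section

namespace GaussianMMD

section Operators

variable {X : Type*} [NormedAddCommGroup X] [InnerProductSpace ℝ X]

/-- Positive (self-adjoint and non-negative) trace class operators: the series of the diagonal
entries `⟪T e, e⟫` converges for a Hilbert basis of the space. -/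
def IsPosTraceClass (T : X →L[ℝ] X) : Prop :=
  T.IsPositive ∧
    ∃ (w : Set X) (e : HilbertBasis w ℝ X), Summable fun i => inner ℝ (T (e i)) (e i)

/-- The determinant of `M = I + A`, for `A = M - I` self-adjoint and trace class, as the product
`∏ (1 + t)` over the eigenvalues `t` of `A` repeated according to multiplicity.
A real `t` that is not an eigenvalue has multiplicity `0` and contributes the factor `1`, and so
does `t = 0` whatever the dimension of its eigenspace. -/
def opDet (M : X →L[ℝ] X) : ℝ :=
  ∏' t : ℝ, (1 + t) ^ Module.finrank ℝ
    (Module.End.eigenspace ((M - 1 : X →L[ℝ] X) : X →ₗ[ℝ] X) t)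

/-- The quadratic form `⟪A v, v⟫`. -/
def quadForm (A : X →L[ℝ] X) (v : X) : ℝ := inner ℝ (A v) v

/-- The inverse of a bounded operator. -/
def opInv (A : X →L[ℝ] X) : X →L[ℝ] X := Ring.inverse A

/-- `P` is the Gaussian measure with mean `m` and covariance operator `C`, where `C` is a positive
trace class operator. -/
structure IsGaussianMeasure [MeasurableSpace X] [BorelSpace X]
    (P : Measure X) (m : X) (C : X →L[ℝ] X) : Prop where
  cov_mem : IsPosTraceClass C
  gaussian : IsGaussian P
  mean_eq : ∫ x, x ∂P = m
  cov_eq : ∀ u v : X, covarianceBilin P u v = inner ℝ (C u) v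

/-- A Gaussian measure is non-degenerate if its covariance operator is injective. -/
def IsNondegenerateGaussian [MeasurableSpace X] [BorelSpace X]
    (P : Measure X) (m : X) (C : X →L[ℝ] X) : Prop :=
  IsGaussianMeasure P m C ∧ Function.Injective C

end Operators

section Kernels

/-- The squared-exponential `T` kernel. -/
def seKernel {X Y : Type*} [NormedAddCommGroup Y] (T : X → Y) (x y : X) : ℝ :=
  Real.exp (-(1 / 2) * ‖T x - T y‖ ^ 2)

/-- The core of the U-statistic estimator of the squared maximum mean discrepancy:
`h(z, z') = k(x, x') + k(y, y') - k(x, y') - k(x', y)` for `z = (x, y)` and `z' = (x', y')`. -/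
def mmdCore {X : Type*} (k : X → X → ℝ) (z z' : X × X) : ℝ :=
  k z.1 z'.1 + k z.2 z'.2 - k z.1 z'.2 - k z'.1 z.2

variable {X : Type*} [MeasurableSpace X]

/-- `ξ₁ = Var_z [E_{z'} h(z, z')]`, for independent `z, z'` with law `P ⊗ Q`. -/
def xiOne (k : X → X → ℝ) (P Q : Measure X) : ℝ :=
  variance (fun z : X × X => ∫ z', mmdCore k z z' ∂(P.prod Q)) (P.prod Q)

/-- `ξ₂ = Var_{z, z'} [h(z, z')]`, for independent `z, z'` with law `P ⊗ Q`. -/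
def xiTwo (k : X → X → ℝ) (P Q : Measure X) : ℝ :=
  variance (fun p : (X × X) × (X × X) => mmdCore k p.1 p.2) ((P.prod Q).prod (P.prod Q))

end Kernels

section ClosedForms

variable {X : Type*} [NormedAddCommGroup X] [InnerProductSpace ℝ X]

/-- `(I + TST)(I + TRT) + TST(2I + T(S + R)T)`. -/
def sigmaOp (T S R : X →L[ℝ] X) : X →L[ℝ] X :=
  (1 + T * S * T) * (1 + T * R * T) + T * S * T * ((2 : ℝ) • 1 + T * (S + R) * T)

/-- The term `α(T, S, R, a, b)` in the closed form of `ξ₁`. -/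
def alphaTerm (T S R : X →L[ℝ] X) (a b : X) : ℝ :=
  opDet ((1 + T * S * T) * (1 + (3 : ℝ) • (T * S * T))) ^ (-(1 / 2) : ℝ)
  - (opDet (1 + (2 : ℝ) • (T * S * T)))⁻¹
  + opDet ((1 + T * R * T) * (1 + T * ((2 : ℝ) • S + R) * T)) ^ (-(1 / 2) : ℝ)
      * Real.exp (-quadForm (opInv (1 + T * ((2 : ℝ) • S + R) * T)) (T (a - b)))
  - (opDet (1 + T * (S + R) * T))⁻¹
      * Real.exp (-quadForm (opInv (1 + T * (S + R) * T)) (T (a - b)))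
  - 2 * opDet (sigmaOp T S R) ^ (-(1 / 2) : ℝ)
      * Real.exp (-(1 / 2) *
          quadForm ((1 + (2 : ℝ) • (T * S * T)) * opInv (sigmaOp T S R)) (T (a - b)))
  + 2 * opDet ((1 + (2 : ℝ) • (T * S * T)) * (1 + T * (S + R) * T)) ^ (-(1 / 2) : ℝ)
      * Real.exp (-(1 / 2) * quadForm (opInv (1 + T * (S + R) * T)) (T (a - b)))

/-- The term `β(T, S, R, a, b)` in the closed form of `ξ₂`. -/
def betaTerm (T S R : X →L[ℝ] X) (a b : X) : ℝ :=
  opDet (1 + (4 : ℝ) • (T * S * T)) ^ (-(1 / 2) : ℝ)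
  - (opDet (1 + (2 : ℝ) • (T * S * T)))⁻¹
  + opDet (1 + (2 : ℝ) • (T * (S + R) * T)) ^ (-(1 / 2) : ℝ)
      * Real.exp (-quadForm (opInv (1 + (2 : ℝ) • (T * (S + R) * T))) (T (a - b)))
  - (opDet (1 + T * (S + R) * T))⁻¹
      * Real.exp (-quadForm (opInv (1 + T * (S + R) * T)) (T (a - b)))
  + 4 * opDet ((1 + T * (S + R) * T) * (1 + (2 : ℝ) • (T * S * T))) ^ (-(1 / 2) : ℝ)
      * Real.exp (-(1 / 2) * quadForm (opInv (1 + T * (S + R) * T)) (T (a - b)))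
  - 4 * opDet (sigmaOp T S R) ^ (-(1 / 2) : ℝ)
      * Real.exp (-(1 / 2) *
          quadForm ((1 + (2 : ℝ) • (T * S * T)) * opInv (sigmaOp T S R)) (T (a - b)))

end ClosedForms

end GaussianMMD

end

/-!
Both variances are polynomial expressions in Gaussian integrals of the kernel. With the kernel mean
embeddings `μ_P(x) = ∫ k(x, y) dP(y)`, expanding `h` shows that `ξ₁` and `ξ₂` only involve
`∫ μ_Q dP`, `∫ μ_P μ_Q dP` and `∫∫ k² dQ dP` (and their variants with `P` and `Q` repeated or
exchanged); this holds for every bounded symmetric kernel (`xiOne_eq`, `xiTwo_eq`).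

To compute these integrals, all operators are diagonalized at once. The covariance `S` is trace
class, hence Hilbert–Schmidt, hence compact, and it is injective; so its eigenspaces are
finite-dimensional and span a dense subspace, and `T` and `R`, which commute with `S` and with each
other, act on each of them as commuting symmetric matrices. This yields a Hilbert basis of joint
eigenvectors (`exists_hilbertBasis_joint_eigenvectors`); no compactness of `T` is needed.

In this basis the coordinates of a Gaussian vector are independent real Gaussians, the kernel is an
infinite product of functions of one coordinate, and the integral of such a product is the product
of the one-dimensional integrals (`IsGaussianMeasure.hasProd_integral`). The latter are explicit
(`integral_exp_quadratic_gaussianReal`). Likewise `det(M)^(-1/2) exp(-⟪N v, v⟫ / 2)` is an infinite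
product over the basis when `M` and `N` are diagonal (`DiagonalIn.hasProd_opDet`,
`DiagonalIn.hasProd_gaussianForm`), so each integral is identified with its closed form factor by
factor, by uniqueness of infinite products.

The mean shift formulas are the case `S = R`, `a = 0`, `b = m` of the general ones.
-/

noncomputable section

open Filter Topology
open scoped RealInnerProductSpace

namespace GaussianMMD

universe u

/-! ### Compactness of positive trace class operators -/

section Compact

variable {X : Type*} [NormedAddCommGroup X] [InnerProductSpace ℝ X]

/-- Cauchy–Schwarz for the positive semidefinite form `⟪S u, v⟫`, applied with `v = S u`. -/
lemma norm_apply_sq_le_of_isPositive {S : X →L[ℝ] X} (hS : S.IsPositive) (u : X) :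
    ‖S u‖ ^ 2 ≤ ‖S‖ * ⟪S u, u⟫ := by
  have hsym : ∀ x y, ⟪S x, y⟫ = ⟪x, S y⟫ := fun x y => hS.isSymmetric x y
  have hpos : ∀ x, 0 ≤ ⟪S x, x⟫ := fun x => by simpa using hS.re_inner_nonneg_left x
  let B : LinearMap.BilinForm ℝ X :=
    LinearMap.mk₂ ℝ (fun x y => ⟪S x, y⟫) (by intros; simp [inner_add_left])
      (by intros; simp [real_inner_smul_left]) (by intros; simp [inner_add_right])
      (by intros; simp [real_inner_smul_right])
  have hB : B.IsSymm := ⟨fun x y => by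
    simp only [B, LinearMap.mk₂_apply]; rw [hsym, real_inner_comm]⟩
  have key : ⟪S u, S u⟫ ^ 2 ≤ ⟪S u, u⟫ * ⟪S (S u), S u⟫ :=
    B.apply_sq_le_of_symm hpos (LinearMap.isSymm_def.2 fun x y => hB.eq x y) u (S u)
  have h2 : ⟪S (S u), S u⟫ ≤ ‖S‖ * ‖S u‖ ^ 2 :=
    (real_inner_le_norm _ _).trans (by
      have := S.le_opNorm (S u)
      nlinarith [norm_nonneg (S u)])
  rw [real_inner_self_eq_norm_sq] at key
  rcases (sq_nonneg ‖S u‖).eq_or_lt with h0 | h0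
  · rw [← h0]; exact mul_nonneg (norm_nonneg _) (hpos u)
  · have h3 := mul_le_mul_of_nonneg_left h2 (hpos u)
    have h4 : ‖S u‖ ^ 2 * ‖S u‖ ^ 2 ≤ (‖S‖ * ⟪S u, u⟫) * ‖S u‖ ^ 2 := by nlinarith
    exact le_of_mul_le_mul_right h4 h0

/-- A Hilbert–Schmidt operator is the norm limit of its compressions `S ∘ P_F` to finite parts `F`
of the basis, hence is compact. -/
lemma isCompactOperator_of_summable_norm_sq [CompleteSpace X] {ι : Type*}
    (e : HilbertBasis ι ℝ X) (S : X →L[ℝ] X) (h : Summable fun i => ‖S (e i)‖ ^ 2) :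
    IsCompactOperator S := by
  let f : Finset ι → X →L[ℝ] X := fun F => ∑ i ∈ F, (innerSL ℝ (e i)).smulRight (S (e i))
  have hfc : ∀ F, IsCompactOperator (f F) := by
    intro F
    have hR : IsCompactOperator (ContinuousLinearMap.id ℝ ℝ) :=
      (isCompactOperator_id_iff_finiteDimensional (𝕜 := ℝ)).2 inferInstance
    have h1 : ∀ i, IsCompactOperator ((innerSL ℝ (e i)).smulRight (S (e i))) := fun i =>
      (hR.clm_comp (ContinuousLinearMap.toSpanSingleton ℝ (S (e i)))).comp_clm (innerSL ℝ (e i))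
    have : f F ∈ compactOperator (RingHom.id ℝ) X X := Submodule.sum_mem _ fun i _ => h1 i
    exact this
  have hbound : ∀ F, ‖f F - S‖ ≤ √((∑' i, ‖S (e i)‖ ^ 2) - ∑ i ∈ F, ‖S (e i)‖ ^ 2) := by
    intro F
    refine ContinuousLinearMap.opNorm_le_bound _ (Real.sqrt_nonneg _) fun x => ?_
    have hs : HasSum (fun i => ⟪e i, x⟫ • S (e i)) (S x) := by
      have := (e.hasSum_repr x).mapL S
      simpa [e.repr_apply_apply] using this
    have hlim : Tendsto (fun G : Finset ι => ‖f F x - ∑ i ∈ G, ⟪e i, x⟫ • S (e i)‖) atTop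
        (𝓝 ‖f F x - S x‖) := (tendsto_const_nhds.sub hs).norm
    refine le_of_tendsto hlim ?_
    filter_upwards [eventually_ge_atTop F] with G hG
    classical
    have hfx : f F x = ∑ i ∈ F, ⟪e i, x⟫ • S (e i) := by simp [f]
    rw [hfx, ← Finset.sum_sdiff hG, sub_add_cancel_right, norm_neg]
    have hx : √(∑ i ∈ G \ F, ⟪e i, x⟫ ^ 2) ≤ ‖x‖ := by
      refine Real.sqrt_le_iff.2 ⟨norm_nonneg _, ?_⟩
      have := e.orthonormal.sum_inner_products_le (s := G \ F) x
      simpa using this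
    have hS : ∑ i ∈ G \ F, ‖S (e i)‖ ^ 2 ≤
        (∑' i, ‖S (e i)‖ ^ 2) - ∑ i ∈ F, ‖S (e i)‖ ^ 2 := by
      rw [le_sub_iff_add_le, Finset.sum_sdiff hG]
      exact h.sum_le_tsum _ fun i _ => sq_nonneg _
    calc ‖∑ i ∈ G \ F, ⟪e i, x⟫ • S (e i)‖ ≤ ∑ i ∈ G \ F, |⟪e i, x⟫| * ‖S (e i)‖ :=
          (norm_sum_le _ _).trans_eq (by simp [norm_smul])
      _ ≤ √(∑ i ∈ G \ F, |⟪e i, x⟫| ^ 2) * √(∑ i ∈ G \ F, ‖S (e i)‖ ^ 2) :=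
          Real.sum_mul_le_sqrt_mul_sqrt _ _ _
      _ ≤ ‖x‖ * √((∑' i, ‖S (e i)‖ ^ 2) - ∑ i ∈ F, ‖S (e i)‖ ^ 2) := by
          simp only [sq_abs]
          gcongr
      _ = _ := mul_comm _ _
  have hlim : Tendsto f atTop (𝓝 S) := by
    rw [tendsto_iff_norm_sub_tendsto_zero]
    refine squeeze_zero (fun _ => norm_nonneg _) hbound ?_
    have h0 : Tendsto (fun F : Finset ι => (∑' i, ‖S (e i)‖ ^ 2) - ∑ i ∈ F, ‖S (e i)‖ ^ 2) atTop
        (𝓝 ((∑' i, ‖S (e i)‖ ^ 2) - ∑' i, ‖S (e i)‖ ^ 2)) := tendsto_const_nhds.sub h.hasSum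
    have := h0.sqrt
    simpa using this
  exact isCompactOperator_of_tendsto hlim (Eventually.of_forall hfc)

lemma IsPosTraceClass.isCompactOperator [CompleteSpace X] {S : X →L[ℝ] X} (hS : IsPosTraceClass S) :
    IsCompactOperator S := by
  obtain ⟨hp, w, e, hs⟩ := hS
  exact isCompactOperator_of_summable_norm_sq e S
    (Summable.of_nonneg_of_le (fun _ => sq_nonneg _)
      (fun i => norm_apply_sq_le_of_isPositive hp (e i)) (hs.mul_left _))

/-! ### Joint diagonalization -/

open Module.End in
/-- Restricting the family to the finite-dimensional invariant subspace reduces this to the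
finite-dimensional theorem. -/
lemma eigenspace_le_iSup_joint_eigenspaces {n : Type*} (L : n → X →ₗ[ℝ] X)
    (hL : ∀ i, (L i).IsSymmetric) (hLc : ∀ i j, Commute (L i) (L j)) (i₀ : n) (μ : ℝ)
    [FiniteDimensional ℝ (eigenspace (L i₀) μ)] :
    eigenspace (L i₀) μ ≤ ⨆ χ : n → ℝ, ⨅ j, eigenspace (L j) (χ j) := by
  have hinv : ∀ j, ∀ x ∈ eigenspace (L i₀) μ, L j x ∈ eigenspace (L i₀) μ := fun j x hx => by
    rw [mem_eigenspace_iff] at hx ⊢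
    have h1 : L i₀ (L j x) = L j (L i₀ x) := congrArg (fun B : X →ₗ[ℝ] X => B x) (hLc i₀ j)
    rw [h1, hx, map_smul]
  let B : n → eigenspace (L i₀) μ →ₗ[ℝ] eigenspace (L i₀) μ :=
    fun j => (L j).restrict (hinv j)
  have htop := LinearMap.IsSymmetric.iSup_iInf_eq_top_of_commute (T := B)
    (fun j => (hL j).restrict_invariant (hinv j)) (fun j k _ => by
      change B j * B k = B k * B j
      ext x
      exact congrArg (fun B : X →ₗ[ℝ] X => B x) (hLc j k))
  rw [← Submodule.map_subtype_top (eigenspace (L i₀) μ), ← htop, Submodule.map_iSup]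
  refine iSup_mono fun χ => ?_
  rintro _ ⟨x, hx, rfl⟩
  refine (Submodule.mem_iInf _).2 fun j => ?_
  have := (Submodule.mem_iInf _).1 hx j
  rw [mem_eigenspace_iff] at this ⊢
  exact congrArg Subtype.val this

/-- Hilbert bases of the members of an orthogonal family of closed subspaces with dense span
combine into a Hilbert basis of the whole space. -/
lemma exists_hilbertBasis_of_orthogonalFamily [CompleteSpace X] {J : Type*} (V : J → Submodule ℝ X)
    (hV : OrthogonalFamily ℝ (fun χ => V χ) fun χ => (V χ).subtypeₗᵢ)
    [∀ χ, CompleteSpace (V χ)] (hdense : (⨆ χ, V χ)ᗮ = ⊥) :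
    ∃ (w : ∀ χ, Set (V χ)) (e : HilbertBasis (Σ χ, w χ) ℝ X), ∀ k, e k ∈ V k.1 := by
  choose w b _ using fun χ => exists_hilbertBasis ℝ (V χ)
  let v : (Σ χ, w χ) → X := fun p => (b p.1 p.2 : X)
  have hv : Orthonormal ℝ v := hV.orthonormal_sigma_orthonormal fun χ => (b χ).orthonormal
  have hsp : (Submodule.span ℝ (Set.range v))ᗮ = ⊥ := by
    rw [← le_bot_iff, ← hdense]
    intro x hx
    rw [Submodule.mem_orthogonal'] at hx ⊢
    intro y hy
    refine Submodule.iSup_induction V (motive := fun y => ⟪x, y⟫ = 0) hy (fun χ y hy => ?_)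
      (inner_zero_right _) (fun y z hy hz => by rw [inner_add_right, hy, hz, add_zero])
    have hs := ((b χ).hasSum_repr ⟨y, hy⟩).mapL ((innerSL ℝ x).comp (V χ).subtypeL)
    have h0 : ∀ i, ⟪x, (b χ i : X)⟫ = 0 := fun i =>
      hx _ (Submodule.subset_span ⟨⟨χ, i⟩, rfl⟩)
    have hz : (fun i => ((innerSL ℝ x).comp (V χ).subtypeL) ((b χ).repr ⟨y, hy⟩ i • b χ i)) =
        fun _ => 0 := by
      funext i
      simp [h0 i]
    rw [hz] at hs
    exact hs.unique hasSum_zero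
  refine ⟨w, HilbertBasis.mkOfOrthogonalEqBot hv hsp, fun k => ?_⟩
  rw [HilbertBasis.coe_mkOfOrthogonalEqBot]
  exact (b k.1 k.2).2

open Module.End in
/-- A commuting family of bounded symmetric operators is jointly diagonalized by a Hilbert basis
as soon as one of them, `A i₀`, is compact and injective: the eigenspaces of `A i₀` for nonzero
eigenvalues are finite-dimensional, invariant, and span a dense subspace. -/
lemma exists_hilbertBasis_joint_eigenvectors {X : Type u} [NormedAddCommGroup X]
    [InnerProductSpace ℝ X] [CompleteSpace X] {n : Type} (A : n → X →L[ℝ] X)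
    (hsym : ∀ i, (A i : X →ₗ[ℝ] X).IsSymmetric) (hcomm : ∀ i j, Commute (A i) (A j)) (i₀ : n)
    (hcpt : IsCompactOperator (A i₀)) (hinj : Function.Injective (A i₀)) :
    ∃ (κ : Type u) (e : HilbertBasis κ ℝ X) (a : n → κ → ℝ), ∀ i k, A i (e k) = a i k • e k := by
  let L : n → X →ₗ[ℝ] X := fun i => (A i : X →ₗ[ℝ] X)
  have hL : ∀ i, (L i).IsSymmetric := hsym
  have hLc : ∀ i j, Commute (L i) (L j) := fun i j => by
    change L i * L j = L j * L i
    ext x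
    exact congrArg (fun B : X →L[ℝ] X => B x) (hcomm i j)
  let V : (n → ℝ) → Submodule ℝ X := fun χ => ⨅ j, eigenspace (L j) (χ j)
  have hV : OrthogonalFamily ℝ (fun χ => V χ) fun χ => (V χ).subtypeₗᵢ :=
    LinearMap.IsSymmetric.orthogonalFamily_iInf_eigenspaces hL
  have hmem : ∀ μ, eigenspace (L i₀) μ ≤ ⨆ χ, V χ := by
    intro μ
    by_cases hμ : μ = 0
    · have : eigenspace (L i₀) 0 = ⊥ := by
        rw [eigenspace_zero]
        exact LinearMap.ker_eq_bot.2 hinj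
      rw [hμ, this]
      exact bot_le
    · have hfin : FiniteDimensional ℝ (eigenspace (L i₀) μ) :=
        ContinuousLinearMap.finite_dimensional_eigenspace hcpt μ hμ
      exact eigenspace_le_iSup_joint_eigenspaces L hL hLc i₀ μ
  have hdense : (⨆ χ, V χ)ᗮ = ⊥ := by
    have h := ContinuousLinearMap.orthogonalComplement_iSup_eigenspaces_eq_bot hcpt (hsym i₀)
    exact le_bot_iff.1 ((Submodule.orthogonal_le (iSup_le hmem)).trans h.le)
  have hVc : ∀ χ, CompleteSpace (V χ) := fun χ => by
    have h : (V χ : Set X) = ⋂ j, {x | A j x = χ j • x} := by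
      ext x
      simp only [V, L, SetLike.mem_coe, Submodule.mem_iInf, mem_eigenspace_iff, Set.mem_iInter,
        Set.mem_ofPred_eq, ContinuousLinearMap.coe_coe]
    have hcl : IsClosed (V χ : Set X) := by
      rw [h]
      exact isClosed_iInter fun j => isClosed_eq (A j).continuous (continuous_const_smul _)
    exact hcl.completeSpace_coe
  obtain ⟨w, e, he⟩ := exists_hilbertBasis_of_orthogonalFamily V hV hdense
  refine ⟨_, e, fun i k => k.1 i, fun i k => ?_⟩
  have := (Submodule.mem_iInf _).1 (he k) i
  rw [mem_eigenspace_iff] at this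
  exact this

/-- The open balls of radius `1 / 2` around the basis vectors are disjoint. -/
lemma HilbertBasis.countable_index [CompleteSpace X] {κ : Type*} [TopologicalSpace.SeparableSpace X]
    (e : HilbertBasis κ ℝ X) : Countable κ := by
  refine Pairwise.countable_of_isOpen_disjoint (s := fun i => Metric.ball (e i) (1 / 2)) ?_
    (fun _ => Metric.isOpen_ball) (fun i => ⟨e i, Metric.mem_ball_self (by norm_num)⟩)
  intro i j hij
  refine Metric.ball_disjoint_ball ?_
  -- distinct members of an orthonormal system are at distance `√2`
  have h : ‖e i - e j‖ ^ 2 = 2 := by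
    rw [norm_sub_sq_real, e.orthonormal.1 i, e.orthonormal.1 j, e.orthonormal.2 hij]
    norm_num
  rw [dist_eq_norm]
  nlinarith [norm_nonneg (e i - e j)]

end Compact

/-! ### Operators diagonal in a Hilbert basis -/

section Diagonal

variable {X κ : Type*} [NormedAddCommGroup X] [InnerProductSpace ℝ X]
  {e : HilbertBasis κ ℝ X} {A B : X →L[ℝ] X} {a b : κ → ℝ}

/-- The operator `A` is diagonal in the Hilbert basis `e`, with diagonal entries `a`. -/
def DiagonalIn (e : HilbertBasis κ ℝ X) (A : X →L[ℝ] X) (a : κ → ℝ) : Prop :=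
  ∀ i, A (e i) = a i • e i

namespace DiagonalIn

lemma one : DiagonalIn e 1 1 := fun i => by simp

lemma add (hA : DiagonalIn e A a) (hB : DiagonalIn e B b) : DiagonalIn e (A + B) (a + b) :=
  fun i => by simp [hA i, hB i, add_smul]

lemma mul (hA : DiagonalIn e A a) (hB : DiagonalIn e B b) : DiagonalIn e (A * B) (a * b) :=
  fun i => by simp [hA i, hB i, smul_smul, mul_comm]

lemma smul (c : ℝ) (hA : DiagonalIn e A a) : DiagonalIn e (c • A) (c • a) :=
  fun i => by simp [hA i, smul_smul]

lemma inner_apply (hA : DiagonalIn e A a) (i : κ) (x : X) : ⟪e i, A x⟫ = a i * ⟪e i, x⟫ := by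
  have h1 : HasSum (fun j => ⟪e j, x⟫ * (a j * ⟪e i, e j⟫)) ⟪e i, A x⟫ := by
    have := (e.hasSum_repr x).mapL ((innerSL ℝ (e i)).comp A)
    simpa [e.repr_apply_apply, hA _, real_inner_smul_right] using this
  refine h1.unique ?_
  have h2 := hasSum_single (f := fun j => ⟪e j, x⟫ * (a j * ⟪e i, e j⟫)) i
    (fun j hj => by rw [e.orthonormal.2 hj.symm]; ring)
  rw [real_inner_self_eq_norm_sq, e.orthonormal.1 i] at h2
  convert! h2 using 1
  ring

lemma hasSum_quadForm (hA : DiagonalIn e A a) (x : X) :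
    HasSum (fun i => a i * ⟪e i, x⟫ ^ 2) (quadForm A x) := by
  convert! e.hasSum_inner_mul_inner (A x) x using 1
  funext i
  rw [real_inner_comm (e i) (A x), hA.inner_apply]
  ring

lemma hasSum_norm_apply_sq (hA : DiagonalIn e A a) (x : X) :
    HasSum (fun i => a i ^ 2 * ⟪e i, x⟫ ^ 2) (‖A x‖ ^ 2) := by
  have h := e.hasSum_inner_mul_inner (A x) (A x)
  rw [real_inner_self_eq_norm_sq] at h
  convert! h using 1
  funext i
  rw [real_inner_comm (e i) (A x), hA.inner_apply]
  ring

lemma entry_nonneg (hA : DiagonalIn e A a) (hp : A.IsPositive) (i : κ) : 0 ≤ a i := by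
  have h : 0 ≤ ⟪A (e i), e i⟫ := by simpa using hp.re_inner_nonneg_left (e i)
  rwa [hA i, real_inner_smul_left, real_inner_self_eq_norm_sq, e.orthonormal.1 i, one_pow,
    mul_one] at h

lemma abs_entry_le (hA : DiagonalIn e A a) (i : κ) : |a i| ≤ ‖A‖ := by
  have := A.le_opNorm (e i)
  rwa [hA i, norm_smul, e.orthonormal.1 i, mul_one, mul_one] at this

/-- A diagonal operator with entries bounded below by `1` is coercive, hence invertible, and its
inverse is diagonal. -/
lemma opInv [CompleteSpace X] (hA : DiagonalIn e A a) (h1 : ∀ i, 1 ≤ a i) :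
    DiagonalIn e (GaussianMMD.opInv A) a⁻¹ := by
  have hu : IsUnit A := by
    refine ContinuousLinearMap.isUnit_of_forall_le_norm_inner_map A (c := 1) one_pos fun x => ?_
    refine le_trans ?_ (le_abs_self _)
    have h := e.hasSum_inner_mul_inner x x
    rw [real_inner_self_eq_norm_sq] at h
    rw [NNReal.coe_one, mul_one]
    refine hasSum_le (fun i => ?_) h (hA.hasSum_quadForm x)
    rw [real_inner_comm]
    nlinarith [h1 i, sq_nonneg ⟪e i, x⟫]
  intro i
  have hne : a i ≠ 0 := (zero_lt_one.trans_le (h1 i)).ne'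
  have h2 : GaussianMMD.opInv A (A (e i)) = e i := by
    have := Ring.inverse_mul_cancel A hu
    exact congrArg (fun B : X →L[ℝ] X => B (e i)) this
  rw [hA i, map_smul] at h2
  rw [Pi.inv_apply, eq_inv_smul_iff₀ hne, h2]

lemma mem_eigenspace_iff (hA : DiagonalIn e A a) (t : ℝ) (x : X) :
    x ∈ Module.End.eigenspace (A : X →ₗ[ℝ] X) t ↔ ∀ i, a i ≠ t → ⟪e i, x⟫ = 0 := by
  rw [Module.End.mem_eigenspace_iff, ContinuousLinearMap.coe_coe]
  constructor
  · intro h i hi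
    have h1 := hA.inner_apply i x
    rw [h, real_inner_smul_right] at h1
    have h2 : (a i - t) * ⟪e i, x⟫ = 0 := by linarith
    exact (mul_eq_zero.1 h2).resolve_left (sub_ne_zero.2 hi)
  · intro h
    refine e.repr.injective ?_
    ext i
    rw [e.repr_apply_apply, e.repr_apply_apply, hA.inner_apply, real_inner_smul_right]
    by_cases hi : a i = t
    · rw [hi]
    · rw [h i hi, mul_zero, mul_zero]

/-- The multiplicity of an eigenvalue is the number of times it occurs on the diagonal. -/
lemma finrank_eigenspace (hA : DiagonalIn e A a) (t : ℝ) [Fintype {i // a i = t}] :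
    Module.finrank ℝ (Module.End.eigenspace (A : X →ₗ[ℝ] X) t) = Fintype.card {i // a i = t} := by
  have hli : LinearIndependent ℝ (fun i : {i // a i = t} => e i) :=
    (e.orthonormal.comp _ Subtype.val_injective).linearIndependent
  have hspan : Module.End.eigenspace (A : X →ₗ[ℝ] X) t =
      Submodule.span ℝ (Set.range fun i : {i // a i = t} => e i) := by
    apply le_antisymm
    · intro x hx
      rw [hA.mem_eigenspace_iff] at hx
      have hs : HasSum (fun i => ⟪e i, x⟫ • e i) x := by
        simpa [e.repr_apply_apply] using e.hasSum_repr x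
      have hx' : x = ∑ i : {i // a i = t}, ⟪e i, x⟫ • e i := by
        have hfin : HasSum (fun i : {i // a i = t} => ⟪e i, x⟫ • e i)
            (∑ i : {i // a i = t}, ⟪e i, x⟫ • e i) := hasSum_fintype _
        refine hs.unique ((hasSum_subtype_iff_of_support_subset ?_).1 hfin)
        intro i hi
        by_contra hne
        exact hi (by simp [hx i hne])
      rw [hx']
      exact Submodule.sum_mem _ fun i _ =>
        Submodule.smul_mem _ _ (Submodule.subset_span ⟨i, rfl⟩)
    · rw [Submodule.span_le]
      rintro _ ⟨i, rfl⟩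
      rw [SetLike.mem_coe, Module.End.mem_eigenspace_iff]
      have := hA i
      rw [i.2] at this
      exact this
  rw [hspan, finrank_span_eq_card hli]

/-- The determinant of a diagonal operator `I + C`, with `C` positive and trace class, is the
product of its diagonal entries: the fibres of the diagonal over the eigenvalues are finite,
except possibly the one over `0`, which contributes only factors `1`. -/
lemma hasProd_opDet {M : X →L[ℝ] X} {c : κ → ℝ} (hM : DiagonalIn e M (1 + c))
    (hs : Summable c) : HasProd (fun i => 1 + c i) (opDet M) := by
  have hC : DiagonalIn e (M - 1) c := fun i => by simp [hM i, add_smul]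
  have hm : Multipliable (fun i => 1 + c i) :=
    Real.multipliable_one_add_of_summable hs
  have hfib : ∀ t : ℝ, HasProd (fun i : {i // c i = t} => 1 + c i)
      ((1 + t) ^ Module.finrank ℝ
        (Module.End.eigenspace ((M - 1 : X →L[ℝ] X) : X →ₗ[ℝ] X) t)) := by
    intro t
    by_cases ht : t = 0
    · subst ht
      have : (fun i : {i // c i = 0} => 1 + c i) = fun _ => 1 := by
        funext i; rw [i.2, add_zero]
      rw [this, add_zero, one_pow]
      exact hasProd_one
    · have hfin : {i | c i = t}.Finite := by
        have hev := hs.tendsto_cofinite_zero.eventually (isOpen_ne.mem_nhds (Ne.symm ht))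
        simpa [Filter.eventually_cofinite] using hev
      have hft : Fintype {i // c i = t} := hfin.fintype
      rw [hC.finrank_eigenspace t]
      have h1 : (1 + t) ^ Fintype.card {i // c i = t} = ∏ i : {i // c i = t}, (1 + c i) := by
        rw [← Finset.card_univ, ← Finset.prod_const]
        exact Finset.prod_congr rfl fun i _ => by rw [i.2]
      rw [h1]
      exact hasProd_fintype _
  have hσ : HasProd (fun p : Σ t : ℝ, {i // c i = t} => 1 + c p.2) (∏' i, (1 + c i)) :=
    (Equiv.sigmaFiberEquiv c).hasProd_iff.2 hm.hasProd
  have := (hσ.sigma hfib).tprod_eq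
  rw [opDet, this]
  exact hm.hasProd

/-- The trace is independent of the basis: by Tonelli the sum of the eigenvalues is the sum of the
diagonal entries in any other Hilbert basis. -/
lemma summable_of_isPosTraceClass (hA : DiagonalIn e A a) (h : IsPosTraceClass A) :
    Summable a := by
  obtain ⟨hp, w, f, hs⟩ := h
  have ha := hA.entry_nonneg hp
  have h1 : ∀ j, HasSum (fun i => a i * ⟪e i, f j⟫ ^ 2) ⟪A (f j), f j⟫ :=
    fun j => hA.hasSum_quadForm (f j)
  have h2 : ∀ i, HasSum (fun j => a i * ⟪e i, f j⟫ ^ 2) (a i) := fun i => by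
    have := (f.hasSum_inner_mul_inner (e i) (e i)).mul_left (a i)
    rw [real_inner_self_eq_norm_sq, e.orthonormal.1 i, one_pow, mul_one] at this
    convert! this using 1
    funext j
    rw [real_inner_comm (e i) (f j)]; ring
  have h3 : Summable fun p : w × κ => a p.2 * ⟪e p.2, f p.1⟫ ^ 2 := by
    rw [summable_prod_of_nonneg fun p => mul_nonneg (ha _) (sq_nonneg _)]
    refine ⟨fun j => (h1 j).summable, ?_⟩
    simpa only [(h1 _).tsum_eq] using hs
  have h4 := ((Equiv.prodComm κ w).summable_iff.2 h3).prod
  refine h4.congr fun i => ?_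
  exact (h2 i).tsum_eq

end DiagonalIn

end Diagonal

/-! ### One-dimensional Gaussian integrals -/

/-- The density of `N(m, v)` times `exp(-γ x² / 2 + δ x)` is a multiple of another Gaussian
density, with precision `1 / v + γ`. -/
lemma integral_exp_quadratic_gaussianReal (m : ℝ) (v : NNReal) {γ : ℝ} (hγ : 0 ≤ γ) (δ : ℝ) :
    ∫ x, Real.exp (-(1 / 2) * γ * x ^ 2 + δ * x) ∂(gaussianReal m v) =
      (1 + γ * v) ^ (-(1 / 2) : ℝ) *
        Real.exp ((-(1 / 2) * γ * m ^ 2 + δ * m + v * δ ^ 2 / 2) / (1 + γ * v)) := by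
  by_cases hv : v = 0
  · subst hv
    rw [gaussianReal_zero_var, integral_dirac]
    simp
  have hv0 : (0 : ℝ) < v := by positivity
  set w : ℝ := 1 + γ * v with hw
  have hw0 : 0 < w := by positivity
  set v' : NNReal := v / w.toNNReal with hv'
  have hv'0 : v' ≠ 0 := by
    have : w.toNNReal ≠ 0 := by simpa using hw0
    exact div_ne_zero hv this
  have hvc : (v' : ℝ) = v / w := by rw [hv', NNReal.coe_div, Real.coe_toNNReal _ hw0.le]
  rw [integral_gaussianReal_eq_integral_smul hv]
  have key : ∀ x, gaussianPDFReal m v x • Real.exp (-(1 / 2) * γ * x ^ 2 + δ * x) =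
      (w ^ (-(1 / 2) : ℝ) *
        Real.exp ((-(1 / 2) * γ * m ^ 2 + δ * m + v * δ ^ 2 / 2) / w)) *
        gaussianPDFReal ((m + v * δ) / w) v' x := by
    intro x
    have h1 : √(2 * Real.pi * v) = √w * √(2 * Real.pi * v') := by
      rw [← Real.sqrt_mul hw0.le, hvc]
      congr 1
      field_simp
    have h2 : w ^ (-(1 / 2) : ℝ) = (√w)⁻¹ := by
      rw [Real.rpow_neg hw0.le, Real.sqrt_eq_rpow]
    rw [gaussianPDFReal, gaussianPDFReal, h1, h2, mul_inv, smul_eq_mul]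
    have h3 : Real.exp (-(x - m) ^ 2 / (2 * v)) * Real.exp (-(1 / 2) * γ * x ^ 2 + δ * x) =
        Real.exp ((-(1 / 2) * γ * m ^ 2 + δ * m + v * δ ^ 2 / 2) / w) *
          Real.exp (-(x - (m + v * δ) / w) ^ 2 / (2 * v')) := by
      rw [← Real.exp_add, ← Real.exp_add, hvc]
      congr 1
      have hw' : γ = (w - 1) / v := by rw [hw]; field_simp; ring
      rw [hw']
      field_simp
      ring
    linear_combination ((√w)⁻¹ * (√(2 * Real.pi * v'))⁻¹) * h3
  simp_rw [key]
  rw [integral_const_mul, integral_gaussianPDFReal_eq_one _ hv'0, mul_one]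

lemma integral_exp_sq_gaussianReal (m : ℝ) (v : NNReal) {c : ℝ} (hc : 0 ≤ c) (y : ℝ) :
    ∫ x, Real.exp (-(1 / 2) * (c * (x - y) ^ 2)) ∂(gaussianReal m v) =
      (1 + c * v) ^ (-(1 / 2) : ℝ) * Real.exp (-(1 / 2) * (c * (m - y) ^ 2 / (1 + c * v))) := by
  have h : ∀ x, Real.exp (-(1 / 2) * (c * (x - y) ^ 2)) =
      Real.exp (-(1 / 2) * c * x ^ 2 + (c * y) * x) * Real.exp (-(1 / 2) * c * y ^ 2) := by
    intro x
    rw [← Real.exp_add]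
    congr 1
    ring
  have hw : 0 < 1 + c * (v : ℝ) := by positivity
  simp_rw [h]
  rw [integral_mul_const, integral_exp_quadratic_gaussianReal m v hc, mul_assoc, ← Real.exp_add]
  congr 2
  field_simp
  ring

/-- The two squares combine into one quadratic polynomial with leading coefficient `c + d`; stated
in a form that needs no division by `c + d`, which may vanish. -/
lemma integral_exp_sq_add_sq_gaussianReal (m : ℝ) (v : NNReal) {c d : ℝ} (hc : 0 ≤ c) (hd : 0 ≤ d)
    (y z : ℝ) :
    ∫ x, Real.exp (-(1 / 2) * (c * (x - y) ^ 2)) * Real.exp (-(1 / 2) * (d * (x - z) ^ 2))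
        ∂(gaussianReal m v) =
      (1 + (c + d) * v) ^ (-(1 / 2) : ℝ) *
        Real.exp (-(1 / 2) *
          ((c * (m - y) ^ 2 + d * (m - z) ^ 2 + c * d * v * (y - z) ^ 2) / (1 + (c + d) * v))) := by
  have h : ∀ x, Real.exp (-(1 / 2) * (c * (x - y) ^ 2)) * Real.exp (-(1 / 2) * (d * (x - z) ^ 2)) =
      Real.exp (-(1 / 2) * (c + d) * x ^ 2 + (c * y + d * z) * x) *
        Real.exp (-(1 / 2) * (c * y ^ 2 + d * z ^ 2)) := by
    intro x
    rw [← Real.exp_add, ← Real.exp_add]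
    congr 1
    ring
  have hw : 0 < 1 + (c + d) * (v : ℝ) := by positivity
  simp_rw [h]
  rw [integral_mul_const, integral_exp_quadratic_gaussianReal m v (add_nonneg hc hd), mul_assoc,
    ← Real.exp_add]
  congr 2
  field_simp
  ring

/-! ### Gaussian measures in an eigenbasis of the covariance -/

section Gaussian

variable {X κ : Type*} [NormedAddCommGroup X] [InnerProductSpace ℝ X] [CompleteSpace X]
  [TopologicalSpace.SeparableSpace X] [MeasurableSpace X] [BorelSpace X]
  {e : HilbertBasis κ ℝ X} {P Q : Measure X} {a b : X} {S R : X →L[ℝ] X} {s r : κ → ℝ}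

lemma IsGaussianMeasure.cov_inner (hP : IsGaussianMeasure P a S) (hS : DiagonalIn e S s) (i j : κ) :
    cov[fun x => ⟪e i, x⟫, fun x => ⟪e j, x⟫; P] = s i * ⟪e i, e j⟫ := by
  have := hP.gaussian
  have : SecondCountableTopology X := UniformSpace.secondCountable_of_separable X
  rw [← covarianceBilin_apply_eq_cov IsGaussian.memLp_two_id, hP.cov_eq, hS i,
    real_inner_smul_left]

lemma IsGaussianMeasure.map_inner (hP : IsGaussianMeasure P a S) (hS : DiagonalIn e S s) (i : κ) :
    P.map (fun x => ⟪e i, x⟫) = gaussianReal ⟪e i, a⟫ (s i).toNNReal := by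
  have := hP.gaussian
  have : SecondCountableTopology X := UniformSpace.secondCountable_of_separable X
  have h := IsGaussian.map_eq_gaussianReal (μ := P) (innerSL ℝ (e i))
  have h1 : (fun x => ⟪e i, x⟫) = innerSL ℝ (e i) := by ext x; simp
  rw [h1, h, IsGaussian.integral_dual, hP.mean_eq, innerSL_apply_apply]
  congr 2
  have h2 := hP.cov_inner hS i i
  rw [covariance_self (by fun_prop), real_inner_self_eq_norm_sq, e.orthonormal.1 i, one_pow,
    mul_one] at h2
  rw [← h1]
  exact h2

lemma IsGaussianMeasure.integral_prod_inner (hP : IsGaussianMeasure P a S)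
    (hS : DiagonalIn e S s) (g : κ → ℝ → ℝ) (hg : ∀ i, Measurable (g i)) (F : Finset κ) :
    ∫ x, ∏ i ∈ F, g i ⟪e i, x⟫ ∂P =
      ∏ i ∈ F, ∫ t, g i t ∂(gaussianReal ⟪e i, a⟫ (s i).toNNReal) := by
  have := hP.gaussian
  have : SecondCountableTopology X := UniformSpace.secondCountable_of_separable X
  have hlaw : HasGaussianLaw (fun (x : X) (i : F) => ⟪e i, x⟫) P :=
    (IsGaussian.hasGaussianLaw_id (μ := P)).map_fun
      (ContinuousLinearMap.pi fun i : F => innerSL ℝ (e i))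
  have hind : iIndepFun (fun (i : F) (x : X) => ⟪e i, x⟫) P := by
    refine hlaw.iIndepFun_of_covariance_eq_zero fun i j hij => ?_
    rw [hP.cov_inner hS, e.orthonormal.2 (Subtype.val_injective.ne hij), mul_zero]
  have h := hind.integral_fun_prod_comp (f := fun i : F => g i) (fun i => by fun_prop)
    (fun i => (hg i).aestronglyMeasurable)
  rw [← Finset.prod_coe_sort F (fun i => ∫ t, g i t ∂(gaussianReal ⟪e i, a⟫ (s i).toNNReal))]
  simp_rw [← Finset.prod_coe_sort F]
  rw [h]
  refine Finset.prod_congr rfl fun i _ => ?_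
  rw [← hP.map_inner hS, integral_map (by fun_prop) (hg i).aestronglyMeasurable]

/-- Integrals of infinite products of functions of single coordinates factorize: the coordinates
are uncorrelated, hence independent, and dominated convergence applies since the factors lie
in `[0, 1]`. -/
lemma IsGaussianMeasure.hasProd_integral (hP : IsGaussianMeasure P a S)
    (hS : DiagonalIn e S s) (g : κ → ℝ → ℝ) (hg : ∀ i, Measurable (g i))
    (h0 : ∀ i t, 0 ≤ g i t) (h1 : ∀ i t, g i t ≤ 1) (G : X → ℝ)
    (hG : ∀ x, HasProd (fun i => g i ⟪e i, x⟫) (G x)) :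
    HasProd (fun i => ∫ t, g i t ∂(gaussianReal ⟪e i, a⟫ (s i).toNNReal)) (∫ x, G x ∂P) := by
  have := hP.gaussian
  have : SecondCountableTopology X := UniformSpace.secondCountable_of_separable X
  have : Countable κ := HilbertBasis.countable_index e
  unfold HasProd
  simp_rw [← hP.integral_prod_inner hS g hg]
  refine tendsto_integral_filter_of_dominated_convergence (fun _ => 1) ?_ ?_
    (integrable_const _) ?_
  · refine Eventually.of_forall fun F => Measurable.aestronglyMeasurable ?_
    exact Finset.measurable_fun_prod _ fun i _ => (hg i).comp (by fun_prop)
  · refine Eventually.of_forall fun F => Eventually.of_forall fun x => ?_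
    rw [Real.norm_of_nonneg (Finset.prod_nonneg fun i _ => h0 i _)]
    exact Finset.prod_le_one (fun i _ => h0 i _) fun i _ => h1 i _
  · exact Eventually.of_forall hG

omit [CompleteSpace X] [TopologicalSpace.SeparableSpace X] in
lemma IsGaussianMeasure.entry_nonneg (hP : IsGaussianMeasure P a S) (hS : DiagonalIn e S s)
    (i : κ) : 0 ≤ s i := hS.entry_nonneg hP.cov_mem.1 i

/-- The kernel `k` is the exponential of minus half the quadratic form of `x - y` with diagonal
entries `l` in the Hilbert basis `e`, written as an infinite product. -/
def IsDiagonalKernel (e : HilbertBasis κ ℝ X) (l : κ → ℝ) (k : X → X → ℝ) : Prop :=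
  ∀ x y, HasProd (fun i => Real.exp (-(1 / 2) * (l i * (⟪e i, x⟫ - ⟪e i, y⟫) ^ 2))) (k x y)

variable {l : κ → ℝ} {k : X → X → ℝ}

/-- The kernel mean embedding of a Gaussian measure. -/
lemma IsDiagonalKernel.hasProd_integral (hk : IsDiagonalKernel e l k) (hl : ∀ i, 0 ≤ l i)
    (hQ : IsGaussianMeasure Q b R) (hR : DiagonalIn e R r) (x : X) :
    HasProd (fun i => (1 + l i * r i) ^ (-(1 / 2) : ℝ) *
      Real.exp (-(1 / 2) * (l i / (1 + l i * r i) * (⟪e i, x⟫ - ⟪e i, b⟫) ^ 2)))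
      (∫ y, k x y ∂Q) := by
  have h := hQ.hasProd_integral hR
    (fun i t => Real.exp (-(1 / 2) * (l i * (t - ⟪e i, x⟫) ^ 2)))
    (fun i => by fun_prop) (fun i t => (Real.exp_pos _).le)
    (fun i t => Real.exp_le_one_iff.2 (by nlinarith [mul_nonneg (hl i) (sq_nonneg (t - ⟪e i, x⟫))]))
    (fun y => k x y) (fun y => by
      convert! hk x y using 1
      funext i
      rw [sub_sq_comm])
  convert! h using 1
  funext i
  rw [integral_exp_sq_gaussianReal _ _ (hl i), Real.coe_toNNReal _ (hQ.entry_nonneg hR i),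
    sub_sq_comm]
  congr 3
  ring

lemma exp_factor_le_one {c d : ℝ} (hc : 0 ≤ c) (hd : 0 ≤ d) :
    (1 + c) ^ (-(1 / 2) : ℝ) * Real.exp (-(1 / 2) * d) ≤ 1 := by
  have h1 : (1 + c) ^ (-(1 / 2) : ℝ) ≤ 1 :=
    Real.rpow_le_one_of_one_le_of_nonpos (by linarith) (by norm_num)
  have h2 : Real.exp (-(1 / 2) * d) ≤ 1 := Real.exp_le_one_iff.2 (by linarith)
  exact mul_le_one₀ h1 (Real.exp_pos _).le h2

lemma IsDiagonalKernel.hasProd_integral_integral (hk : IsDiagonalKernel e l k) (hl : ∀ i, 0 ≤ l i)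
    (hP : IsGaussianMeasure P a S) (hS : DiagonalIn e S s)
    (hQ : IsGaussianMeasure Q b R) (hR : DiagonalIn e R r) :
    HasProd (fun i => (1 + l i * (s i + r i)) ^ (-(1 / 2) : ℝ) *
      Real.exp (-(1 / 2) * (l i * (⟪e i, a⟫ - ⟪e i, b⟫) ^ 2 / (1 + l i * (s i + r i)))))
      (∫ x, ∫ y, k x y ∂Q ∂P) := by
  have hs := hP.entry_nonneg hS
  have hr := hQ.entry_nonneg hR
  have hlr : ∀ i, 0 ≤ l i * r i := fun i => mul_nonneg (hl i) (hr i)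
  have hls : ∀ i, 0 ≤ l i * s i := fun i => mul_nonneg (hl i) (hs i)
  have hd : ∀ i, 0 ≤ l i / (1 + l i * r i) := fun i => div_nonneg (hl i) (by linarith [hlr i])
  have h := hP.hasProd_integral hS
    (fun i t => (1 + l i * r i) ^ (-(1 / 2) : ℝ) *
      Real.exp (-(1 / 2) * (l i / (1 + l i * r i) * (t - ⟪e i, b⟫) ^ 2)))
    (fun i => by fun_prop)
    (fun i t => mul_nonneg (Real.rpow_nonneg (by linarith [hlr i]) _) (Real.exp_pos _).le)
    (fun i t => exp_factor_le_one (hlr i) (mul_nonneg (hd i) (sq_nonneg _)))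
    _ (fun x => hk.hasProd_integral hl hQ hR x)
  convert! h using 1
  funext i
  have hA : 0 < 1 + l i * r i := by linarith [hlr i]
  have hB : 0 < 1 + l i / (1 + l i * r i) * s i := by
    have := mul_nonneg (hd i) (hs i); linarith
  have hAB : (1 + l i * r i) * (1 + l i / (1 + l i * r i) * s i) = 1 + l i * (s i + r i) := by
    field_simp
    ring
  rw [integral_const_mul, integral_exp_sq_gaussianReal _ _ (hd i), Real.coe_toNNReal _ (hs i),
    ← mul_assoc, ← Real.mul_rpow hA.le hB.le, hAB]
  congr 3
  rw [← hAB]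
  field_simp

/-- The integral of the product of two kernel mean embeddings. -/
lemma IsDiagonalKernel.hasProd_integral_mul (hk : IsDiagonalKernel e l k) (hl : ∀ i, 0 ≤ l i)
    (hP : IsGaussianMeasure P a S) (hS : DiagonalIn e S s)
    (hQ : IsGaussianMeasure Q b R) (hR : DiagonalIn e R r)
    {Q' : Measure X} {b' : X} {R' : X →L[ℝ] X} {r' : κ → ℝ}
    (hQ' : IsGaussianMeasure Q' b' R') (hR' : DiagonalIn e R' r') :
    HasProd (fun i =>
      ((1 + l i * r i) * (1 + l i * r' i) + l i * s i * (2 + l i * r i + l i * r' i))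
        ^ (-(1 / 2) : ℝ) *
      Real.exp (-(1 / 2) * (l i * ((1 + l i * r' i) * (⟪e i, a⟫ - ⟪e i, b⟫) ^ 2
          + (1 + l i * r i) * (⟪e i, a⟫ - ⟪e i, b'⟫) ^ 2
          + l i * s i * (⟪e i, b⟫ - ⟪e i, b'⟫) ^ 2) /
        ((1 + l i * r i) * (1 + l i * r' i) + l i * s i * (2 + l i * r i + l i * r' i)))))
      (∫ x, (∫ y, k x y ∂Q) * (∫ y, k x y ∂Q') ∂P) := by
  have hs := hP.entry_nonneg hS
  have hls : ∀ i, 0 ≤ l i * s i := fun i => mul_nonneg (hl i) (hs i)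
  have hlr : ∀ i, 0 ≤ l i * r i := fun i => mul_nonneg (hl i) (hQ.entry_nonneg hR i)
  have hlr' : ∀ i, 0 ≤ l i * r' i := fun i => mul_nonneg (hl i) (hQ'.entry_nonneg hR' i)
  have hd : ∀ i, 0 ≤ l i / (1 + l i * r i) := fun i => div_nonneg (hl i) (by linarith [hlr i])
  have hd' : ∀ i, 0 ≤ l i / (1 + l i * r' i) := fun i => div_nonneg (hl i) (by linarith [hlr' i])
  have hn : ∀ i t, 0 ≤ (1 + l i * r i) ^ (-(1 / 2) : ℝ) *
      Real.exp (-(1 / 2) * (l i / (1 + l i * r i) * (t - ⟪e i, b⟫) ^ 2)) := fun i t =>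
    mul_nonneg (Real.rpow_nonneg (by linarith [hlr i]) _) (Real.exp_pos _).le
  have hn' : ∀ i t, 0 ≤ (1 + l i * r' i) ^ (-(1 / 2) : ℝ) *
      Real.exp (-(1 / 2) * (l i / (1 + l i * r' i) * (t - ⟪e i, b'⟫) ^ 2)) := fun i t =>
    mul_nonneg (Real.rpow_nonneg (by linarith [hlr' i]) _) (Real.exp_pos _).le
  have h := hP.hasProd_integral hS
    (fun i t => ((1 + l i * r i) ^ (-(1 / 2) : ℝ) *
      Real.exp (-(1 / 2) * (l i / (1 + l i * r i) * (t - ⟪e i, b⟫) ^ 2))) *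
      ((1 + l i * r' i) ^ (-(1 / 2) : ℝ) *
      Real.exp (-(1 / 2) * (l i / (1 + l i * r' i) * (t - ⟪e i, b'⟫) ^ 2))))
    (fun i => by fun_prop)
    (fun i t => mul_nonneg (hn i t) (hn' i t))
    (fun i t => mul_le_one₀ (exp_factor_le_one (hlr i) (mul_nonneg (hd i) (sq_nonneg _)))
      (hn' i t) (exp_factor_le_one (hlr' i) (mul_nonneg (hd' i) (sq_nonneg _))))
    _ (fun x => (hk.hasProd_integral hl hQ hR x).mul (hk.hasProd_integral hl hQ' hR' x))
  convert! h using 1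
  funext i
  have hA : 0 < 1 + l i * r i := by linarith [hlr i]
  have hA' : 0 < 1 + l i * r' i := by linarith [hlr' i]
  have hB : 0 < 1 + (l i / (1 + l i * r i) + l i / (1 + l i * r' i)) * s i := by
    have := mul_nonneg (add_nonneg (hd i) (hd' i)) (hs i); linarith
  have hAB : (1 + l i * r i) * (1 + l i * r' i) *
      (1 + (l i / (1 + l i * r i) + l i / (1 + l i * r' i)) * s i) =
      (1 + l i * r i) * (1 + l i * r' i) + l i * s i * (2 + l i * r i + l i * r' i) := by
    field_simp
    ring
  simp_rw [mul_mul_mul_comm _ (Real.exp _)]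
  rw [integral_const_mul, integral_exp_sq_add_sq_gaussianReal _ _ (hd i) (hd' i),
    Real.coe_toNNReal _ (hs i), ← mul_assoc, ← Real.mul_rpow hA.le hA'.le,
    ← Real.mul_rpow (mul_pos hA hA').le hB.le, hAB]
  congr 3
  rw [← hAB]
  field_simp

end Gaussian

/-! ### The variances for a bounded symmetric kernel -/

section Variances

variable {X : Type*} [MeasurableSpace X]

/-- `∫ f ∂μ = a`, with `f` integrable. -/
def HasIntegral {Ω : Type*} [MeasurableSpace Ω] (μ : Measure Ω) (f : Ω → ℝ) (a : ℝ) : Prop :=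
  Integrable f μ ∧ ∫ x, f x ∂μ = a

namespace HasIntegral

variable {Ω : Type*} [MeasurableSpace Ω] {μ : Measure Ω} {f g : Ω → ℝ} {a b : ℝ}

lemma add (hf : HasIntegral μ f a) (hg : HasIntegral μ g b) :
    HasIntegral μ (fun x => f x + g x) (a + b) :=
  ⟨hf.1.add hg.1, by rw [integral_add hf.1 hg.1, hf.2, hg.2]⟩

lemma sub (hf : HasIntegral μ f a) (hg : HasIntegral μ g b) :
    HasIntegral μ (fun x => f x - g x) (a - b) :=
  ⟨hf.1.sub hg.1, by rw [integral_sub hf.1 hg.1, hf.2, hg.2]⟩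

lemma const_mul (c : ℝ) (hf : HasIntegral μ f a) : HasIntegral μ (fun x => c * f x) (c * a) :=
  ⟨hf.1.const_mul c, by rw [integral_const_mul, hf.2]⟩

lemma swap [SFinite μ] {F : Ω × Ω → ℝ} (hF : HasIntegral (μ.prod μ) F a) :
    HasIntegral (μ.prod μ) (fun p => F p.swap) a :=
  ⟨hF.1.swap, by rw [integral_prod_swap, hF.2]⟩

end HasIntegral

lemma variance_eq_of_hasIntegral {Ω : Type*} [MeasurableSpace Ω] {μ : Measure Ω}
    [IsProbabilityMeasure μ] {f : Ω → ℝ} {a b : ℝ} (hm : Measurable f)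
    (h1 : HasIntegral μ f a) (h2 : HasIntegral μ (fun x => f x ^ 2) b) :
    variance f μ = b - a ^ 2 := by
  have hL : MemLp f 2 μ := (memLp_two_iff_integrable_sq hm.aestronglyMeasurable).2 h2.1
  rw [variance_eq_sub hL, h1.2]
  congr 1
  exact h2.2

lemma integrable_of_abs_le_one {Ω : Type*} [MeasurableSpace Ω] {μ : Measure Ω} [IsFiniteMeasure μ]
    {f : Ω → ℝ} (hm : Measurable f) (h : ∀ x, |f x| ≤ 1) : Integrable f μ :=
  Integrable.of_bound hm.aestronglyMeasurable 1 (Eventually.of_forall h)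

/-- A symmetric measurable kernel with values in `[-1, 1]`. -/
structure IsBoundedKernel (k : X → X → ℝ) : Prop where
  measurable : Measurable (Function.uncurry k)
  abs_le_one : ∀ x y, |k x y| ≤ 1
  symm : ∀ x y, k x y = k y x

variable {k : X → X → ℝ} {P Q : Measure X} [IsProbabilityMeasure P] [IsProbabilityMeasure Q]

/-- The kernel mean embedding `x ↦ ∫ k(x, y) dP(y)`. -/
def meanEmb (k : X → X → ℝ) (P : Measure X) (x : X) : ℝ := ∫ y, k x y ∂P

/-- The pairing `∫∫ k(x, y) dQ(y) dP(x)` of the mean embeddings of `P` and `Q`. -/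
def kernelPair (k : X → X → ℝ) (P Q : Measure X) : ℝ := ∫ x, meanEmb k Q x ∂P

namespace IsBoundedKernel

lemma measurable₂ (hk : IsBoundedKernel k) {Ω : Type*} [MeasurableSpace Ω] {f g : Ω → X}
    (hf : Measurable f) (hg : Measurable g) : Measurable fun x => k (f x) (g x) :=
  hk.measurable.comp (hf.prodMk hg)

lemma measurable_meanEmb (hk : IsBoundedKernel k) (P : Measure X) [IsProbabilityMeasure P] :
    Measurable (meanEmb k P) :=
  (hk.measurable.stronglyMeasurable.integral_prod_right (ν := P)).measurable

lemma abs_meanEmb_le_one (hk : IsBoundedKernel k) (P : Measure X) [IsProbabilityMeasure P] (x : X) :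
    |meanEmb k P x| ≤ 1 := by
  have := norm_integral_le_of_norm_le_const (μ := P) (f := k x) (C := 1)
    (Eventually.of_forall fun y => hk.abs_le_one x y)
  simpa [meanEmb] using this

lemma kernelPair_comm (hk : IsBoundedKernel k) : kernelPair k Q P = kernelPair k P Q := by
  unfold kernelPair meanEmb
  rw [integral_integral_swap]
  · simp_rw [hk.symm]
  · exact integrable_of_abs_le_one hk.measurable fun p => hk.abs_le_one _ _

end IsBoundedKernel

lemma abs_mul_le_one {x y : ℝ} (hx : |x| ≤ 1) (hy : |y| ≤ 1) : |x * y| ≤ 1 := by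
  rw [abs_mul]; exact mul_le_one₀ hx (abs_nonneg _) hy

lemma integral_mmdCore (hk : IsBoundedKernel k) (z : X × X) :
    ∫ z', mmdCore k z z' ∂(P.prod Q) =
      (meanEmb k P z.1 - meanEmb k Q z.1) - (meanEmb k P z.2 - meanEmb k Q z.2) := by
  have h1 : ∀ x, HasIntegral (P.prod Q) (fun z' : X × X => k x z'.1) (meanEmb k P x) := fun x =>
    ⟨integrable_of_abs_le_one (hk.measurable₂ measurable_const measurable_fst)
      fun _ => hk.abs_le_one _ _, by rw [integral_fun_fst (f := k x)]; simp [meanEmb]⟩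
  have h2 : ∀ x, HasIntegral (P.prod Q) (fun z' : X × X => k x z'.2) (meanEmb k Q x) := fun x =>
    ⟨integrable_of_abs_le_one (hk.measurable₂ measurable_const measurable_snd)
      fun _ => hk.abs_le_one _ _, by rw [integral_fun_snd (f := k x)]; simp [meanEmb]⟩
  have h := (((h1 z.1).add (h2 z.2)).sub (h2 z.1)).sub (h1 z.2)
  have hz : ∀ z', mmdCore k z z' = k z.1 z'.1 + k z.2 z'.2 - k z.1 z'.2 - k z.2 z'.1 := fun z' => by
    rw [mmdCore, hk.symm z'.1]
  simp_rw [hz]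
  rw [h.2]
  ring

/-- The Hoeffding projection of `h` is the difference at `x` and `y` of the witness function
`f = μ_P - μ_Q`, so `ξ₁ = Var_P f + Var_Q f`. -/
theorem xiOne_eq (hk : IsBoundedKernel k) :
    xiOne k P Q =
      ((∫ x, meanEmb k P x * meanEmb k P x ∂P) - 2 * (∫ x, meanEmb k P x * meanEmb k Q x ∂P)
        + (∫ x, meanEmb k Q x * meanEmb k Q x ∂P) - (kernelPair k P P - kernelPair k P Q) ^ 2)
      + ((∫ x, meanEmb k Q x * meanEmb k Q x ∂Q) - 2 * (∫ x, meanEmb k Q x * meanEmb k P x ∂Q)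
        + (∫ x, meanEmb k P x * meanEmb k P x ∂Q)
        - (kernelPair k Q Q - kernelPair k P Q) ^ 2) := by
  have hm := fun (M : Measure X) (_ : IsProbabilityMeasure M) => hk.measurable_meanEmb M
  have hb := fun (M : Measure X) (_ : IsProbabilityMeasure M) => hk.abs_meanEmb_le_one M
  have i1 : ∀ (M N : Measure X) [IsProbabilityMeasure M] [IsProbabilityMeasure N],
      HasIntegral M (meanEmb k N) (kernelPair k M N) := fun M N _ _ =>
    ⟨integrable_of_abs_le_one (hm N ‹_›) (hb N ‹_›), rfl⟩
  have i2 : ∀ (M N N' : Measure X) [IsProbabilityMeasure M] [IsProbabilityMeasure N]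
      [IsProbabilityMeasure N'], HasIntegral M (fun x => meanEmb k N x * meanEmb k N' x)
        (∫ x, meanEmb k N x * meanEmb k N' x ∂M) := fun M N N' _ _ _ =>
    ⟨integrable_of_abs_le_one ((hm N ‹_›).mul (hm N' ‹_›))
      fun x => abs_mul_le_one (hb N ‹_› x) (hb N' ‹_› x), rfl⟩
  have fst : ∀ {f : X → ℝ} {a : ℝ}, HasIntegral P f a →
      HasIntegral (P.prod Q) (fun z => f z.1) a := fun {f a} h =>
    ⟨h.1.comp_fst Q, by rw [integral_fun_fst (f := f), h.2]; simp⟩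
  have snd : ∀ {f : X → ℝ} {a : ℝ}, HasIntegral Q f a →
      HasIntegral (P.prod Q) (fun z => f z.2) a := fun {f a} h =>
    ⟨h.1.comp_snd P, by rw [integral_fun_snd (f := f), h.2]; simp⟩
  have cross : ∀ {f g : X → ℝ} {a b : ℝ}, HasIntegral P f a → HasIntegral Q g b →
      HasIntegral (P.prod Q) (fun z => f z.1 * g z.2) (a * b) := fun {f g a b} h h' =>
    ⟨h.1.mul_prod h'.1, by rw [integral_prod_mul, h.2, h'.2]⟩
  have hP1 := (i1 P P).sub (i1 P Q)
  have hQ1 := (i1 Q P).sub (i1 Q Q)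
  have hP2 := ((i2 P P P).sub ((i2 P P Q).const_mul 2)).add (i2 P Q Q)
  have hQ2 := ((i2 Q Q Q).sub ((i2 Q Q P).const_mul 2)).add (i2 Q P P)
  have h1 := (fst hP1).sub (snd hQ1)
  have h2 := ((fst hP2).add (snd hQ2)).sub ((cross hP1 hQ1).const_mul 2)
  have hfun : (fun z : X × X => ∫ z', mmdCore k z z' ∂(P.prod Q)) = fun z =>
      (meanEmb k P z.1 - meanEmb k Q z.1) - (meanEmb k P z.2 - meanEmb k Q z.2) :=
    funext fun z => integral_mmdCore hk z
  rw [xiOne, hfun]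
  have hmeas : Measurable fun z : X × X =>
      (meanEmb k P z.1 - meanEmb k Q z.1) - (meanEmb k P z.2 - meanEmb k Q z.2) :=
    (((hm P ‹_›).comp measurable_fst).sub ((hm Q ‹_›).comp measurable_fst)).sub
      (((hm P ‹_›).comp measurable_snd).sub ((hm Q ‹_›).comp measurable_snd))
  rw [variance_eq_of_hasIntegral hmeas h1 (by
    convert! h2 using 1
    funext z
    ring), hk.kernelPair_comm (P := P) (Q := Q)]
  ring

lemma hasIntegral_prod_prod {F : (X × X) × (X × X) → ℝ} (hm : Measurable F) (hF : ∀ p, |F p| ≤ 1)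
    {c : ℝ} (hc : ∫ x, ∫ y, ∫ x', ∫ y', F ((x, y), (x', y')) ∂Q ∂P ∂Q ∂P = c) :
    HasIntegral ((P.prod Q).prod (P.prod Q)) F c := by
  refine ⟨integrable_of_abs_le_one hm hF, ?_⟩
  have h1 : ∀ z, ∫ z', F (z, z') ∂(P.prod Q) = ∫ x', ∫ y', F (z, (x', y')) ∂Q ∂P := fun z =>
    integral_prod _ (integrable_of_abs_le_one (hm.comp measurable_prodMk_left) fun _ => hF _)
  rw [integral_prod _ (integrable_of_abs_le_one hm hF), integral_prod]
  · simp_rw [h1]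
    exact hc
  · refine integrable_of_abs_le_one hm.stronglyMeasurable.integral_prod_right'.measurable
      fun z => ?_
    have := norm_integral_le_of_norm_le_const (μ := P.prod Q) (f := fun z' => F (z, z')) (C := 1)
      (Eventually.of_forall fun _ => hF _)
    simpa using this

/-- The pairs among `k(x, x')`, `k(y, y')`, `k(x, y')`, `k(x', y)` that share no variable are
uncorrelated; the remaining covariances integrate a product of two mean embeddings. -/
theorem xiTwo_eq (hk : IsBoundedKernel k) :
    xiTwo k P Q =
      kernelPair (fun x y => k x y ^ 2) P P - kernelPair k P P ^ 2
      + (kernelPair (fun x y => k x y ^ 2) Q Q - kernelPair k Q Q ^ 2)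
      + 2 * (kernelPair (fun x y => k x y ^ 2) P Q - kernelPair k P Q ^ 2)
      - 4 * ((∫ x, meanEmb k P x * meanEmb k Q x ∂P) - kernelPair k P P * kernelPair k P Q)
      - 4 * ((∫ x, meanEmb k Q x * meanEmb k P x ∂Q) - kernelPair k Q Q * kernelPair k P Q) := by
  have hQP : kernelPair k Q P = kernelPair k P Q := hk.kernelPair_comm
  have hk2 : IsBoundedKernel (fun x y => k x y ^ 2) :=
    ⟨hk.measurable.pow_const 2, fun x y => by
      rw [sq]; exact abs_mul_le_one (hk.abs_le_one x y) (hk.abs_le_one x y),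
      fun x y => by rw [hk.symm]⟩
  have hQP2 : kernelPair (fun x y => k x y ^ 2) Q P = kernelPair (fun x y => k x y ^ 2) P Q :=
    hk2.kernelPair_comm
  let k1 : (X × X) × (X × X) → ℝ := fun p => k p.1.1 p.2.1
  let k2 : (X × X) × (X × X) → ℝ := fun p => k p.1.2 p.2.2
  let k3 : (X × X) × (X × X) → ℝ := fun p => k p.1.1 p.2.2
  let k4 : (X × X) × (X × X) → ℝ := fun p => k p.1.2 p.2.1
  have m1 : Measurable k1 := hk.measurable₂ (by fun_prop) (by fun_prop)
  have m2 : Measurable k2 := hk.measurable₂ (by fun_prop) (by fun_prop)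
  have m3 : Measurable k3 := hk.measurable₂ (by fun_prop) (by fun_prop)
  have m4 : Measurable k4 := hk.measurable₂ (by fun_prop) (by fun_prop)
  have b1 : ∀ p, |k1 p| ≤ 1 := fun p => hk.abs_le_one _ _
  have b2 : ∀ p, |k2 p| ≤ 1 := fun p => hk.abs_le_one _ _
  have b3 : ∀ p, |k3 p| ≤ 1 := fun p => hk.abs_le_one _ _
  have b4 : ∀ p, |k4 p| ≤ 1 := fun p => hk.abs_le_one _ _
  have pr : ∀ {f g : (X × X) × (X × X) → ℝ} {c : ℝ}, Measurable f → Measurable g →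
      (∀ p, |f p| ≤ 1) → (∀ p, |g p| ≤ 1) →
      ∫ x, ∫ y, ∫ x', ∫ y', f ((x, y), (x', y')) * g ((x, y), (x', y')) ∂Q ∂P ∂Q ∂P = c →
      HasIntegral ((P.prod Q).prod (P.prod Q)) (fun p => f p * g p) c := fun hf hg bf bg h =>
    hasIntegral_prod_prod (hf.mul hg) (fun p => abs_mul_le_one (bf p) (bg p)) h
  have e1 := hasIntegral_prod_prod (P := P) (Q := Q) (c := kernelPair k P P) m1 b1 (by
    simp [k1, kernelPair, meanEmb])
  have e2 := hasIntegral_prod_prod (P := P) (Q := Q) (c := kernelPair k Q Q) m2 b2 (by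
    simp [k2, kernelPair, meanEmb])
  have e3 := hasIntegral_prod_prod (P := P) (Q := Q) (c := kernelPair k P Q) m3 b3 (by
    simp [k3, kernelPair, meanEmb])
  have e4 := hasIntegral_prod_prod (P := P) (Q := Q) (c := kernelPair k P Q) m4 b4 (by
    rw [← hQP]
    simp [k4, kernelPair, meanEmb])
  have e11 := pr (c := kernelPair (fun x y => k x y ^ 2) P P) m1 m1 b1 b1 (by
    simp [k1, kernelPair, meanEmb, ← sq])
  have e22 := pr (c := kernelPair (fun x y => k x y ^ 2) Q Q) m2 m2 b2 b2 (by
    simp [k2, kernelPair, meanEmb, ← sq])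
  have e33 := pr (c := kernelPair (fun x y => k x y ^ 2) P Q) m3 m3 b3 b3 (by
    simp [k3, kernelPair, meanEmb, ← sq])
  have e44 := pr (c := kernelPair (fun x y => k x y ^ 2) P Q) m4 m4 b4 b4 (by
    rw [← hQP2]
    simp [k4, kernelPair, meanEmb, ← sq])
  have e12 := pr (c := kernelPair k P P * kernelPair k Q Q) m1 m2 b1 b2 (by
    simp [k1, k2, kernelPair, meanEmb, integral_const_mul, integral_mul_const])
  have e34 := pr (c := kernelPair k P Q * kernelPair k P Q) m3 m4 b3 b4 (by
    nth_rw 2 [← hQP]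
    simp [k3, k4, kernelPair, meanEmb, integral_const_mul, integral_mul_const])
  have e13 := pr (c := ∫ x, meanEmb k P x * meanEmb k Q x ∂P) m1 m3 b1 b3 (by
    simp [k1, k3, meanEmb, integral_const_mul, integral_mul_const])
  have e24 := pr (c := ∫ x, meanEmb k Q x * meanEmb k P x ∂Q) m2 m4 b2 b4 (by
    simp [k2, k4, meanEmb, integral_const_mul, integral_mul_const])
  -- the exchange of `z` and `z'` fixes `k1` and `k2` and interchanges `k3` and `k4`
  have e14 := e13.swap
  have e23 := e24.swap
  have hm : Measurable fun p : (X × X) × (X × X) => mmdCore k p.1 p.2 :=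
    ((m1.add m2).sub m3).sub (hk.measurable₂ (by fun_prop) (by fun_prop))
  rw [xiTwo, variance_eq_of_hasIntegral hm (a := kernelPair k P P + kernelPair k Q Q -
      kernelPair k P Q - kernelPair k P Q) (by
    convert! ((e1.add e2).sub e3).sub e4 using 1
    funext p
    simp only [mmdCore, k1, k2, k3, k4]
    rw [hk.symm p.2.1 p.1.2]) (by
    convert! ((((((e11.add e22).add e33).add e44).add (e12.const_mul 2)).add
      (e34.const_mul 2)).sub ((e13.add e14).const_mul 2)).sub ((e23.add e24).const_mul 2) using 1
    funext p
    simp only [mmdCore, k1, k2, k3, k4, Prod.fst_swap, Prod.snd_swap]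
    rw [hk.symm p.2.1 p.1.1, hk.symm p.2.2 p.1.2, hk.symm p.2.1 p.1.2, hk.symm p.2.2 p.1.1]
    ring)]
  ring

end Variances

/-! ### Closed forms -/

lemma one_le_of_hasProd_one_le {κ : Type*} {d : κ → ℝ} {D : ℝ} (h : HasProd d D)
    (h1 : ∀ i, 1 ≤ d i) : 1 ≤ D :=
  ge_of_tendsto' h fun F => by
    have := Finset.prod_le_prod (s := F) (f := fun _ => (1 : ℝ)) (g := d)
      (fun _ _ => zero_le_one) fun i _ => h1 i
    simpa using this

lemma hasProd_rpow {κ : Type*} {d : κ → ℝ} {D : ℝ} (h : HasProd d D) (h1 : ∀ i, 1 ≤ d i) (p : ℝ) :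
    HasProd (fun i => d i ^ p) (D ^ p) := by
  have hD : D ≠ 0 := (zero_lt_one.trans_le (one_le_of_hasProd_one_le h h1)).ne'
  have h2 := h.rpow_const (p := p) (Or.inl hD)
  refine h2.congr fun F => ?_
  rw [Real.finsetProd_rpow _ _ fun i _ => zero_le_one.trans (h1 i)]

section

variable {X κ : Type*} [NormedAddCommGroup X] [InnerProductSpace ℝ X]
  {e : HilbertBasis κ ℝ X} {M M' N : X →L[ℝ] X} {c c' n : κ → ℝ}

lemma quadForm_neg (A : X →L[ℝ] X) (v : X) : quadForm A (-v) = quadForm A v := by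
  simp [quadForm]

lemma quadForm_zero (A : X →L[ℝ] X) : quadForm A 0 = 0 := by
  simp [quadForm]

lemma quadForm_smul (t : ℝ) (A : X →L[ℝ] X) (v : X) : quadForm (t • A) v = t * quadForm A v := by
  simp [quadForm, real_inner_smul_left]

lemma DiagonalIn.one_le_opDet (hM : DiagonalIn e M (1 + c)) (hc : ∀ i, 0 ≤ c i)
    (hs : Summable c) : 1 ≤ opDet M :=
  one_le_of_hasProd_one_le (hM.hasProd_opDet hs) fun i => by linarith [hc i]

lemma DiagonalIn.opDet_mul (hM : DiagonalIn e M (1 + c)) (hc : ∀ i, 0 ≤ c i) (hs : Summable c)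
    (hM' : DiagonalIn e M' (1 + c')) (hc' : ∀ i, 0 ≤ c' i) (hs' : Summable c') :
    opDet (M * M') = opDet M * opDet M' := by
  have hMM : DiagonalIn e (M * M') (1 + (c + c' + c * c')) := by
    have := hM.mul hM'
    convert! this using 1
    ring
  have hcc : Summable (c * c') := by
    refine Summable.of_nonneg_of_le (fun i => mul_nonneg (hc i) (hc' i))
      (fun i => mul_le_mul_of_nonneg_right (hs.le_tsum i fun j _ => hc j) (hc' i))
      (hs'.mul_left (∑' i, c i))
  refine (hMM.hasProd_opDet ((hs.add hs').add hcc)).unique ?_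
  convert! (hM.hasProd_opDet hs).mul (hM'.hasProd_opDet hs') using 1
  funext i
  simp only [Pi.add_apply, Pi.mul_apply]
  ring

/-- `det(M)^(-1/2) exp(-⟪N v, v⟫ / 2)` as a product over the eigenbasis. -/
lemma DiagonalIn.hasProd_gaussianForm (hM : DiagonalIn e M (1 + c)) (hc : ∀ i, 0 ≤ c i)
    (hs : Summable c) (hN : DiagonalIn e N n) (v : X) :
    HasProd (fun i => (1 + c i) ^ (-(1 / 2) : ℝ) * Real.exp (-(1 / 2) * (n i * ⟪e i, v⟫ ^ 2)))
      (opDet M ^ (-(1 / 2) : ℝ) * Real.exp (-(1 / 2) * quadForm N v)) :=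
  (hasProd_rpow (hM.hasProd_opDet hs) (fun i => by linarith [hc i]) _).mul
    ((hN.hasSum_quadForm v).mul_left (-(1 / 2))).rexp

end

section

variable {X : Type u} {κ : Type u} [NormedAddCommGroup X] [InnerProductSpace ℝ X]
  [MeasurableSpace X] [BorelSpace X]

/-- `P = N(a, S)` and `Q = N(b, R)`, and the Hilbert basis `e` diagonalizes `T`, `S`, `R`. -/
structure JointlyDiagonal (e : HilbertBasis κ ℝ X) (T S R : X →L[ℝ] X) (t s r : κ → ℝ)
    (P Q : Measure X) (a b : X) : Prop where
  diag_T : DiagonalIn e T t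
  diag_S : DiagonalIn e S s
  diag_R : DiagonalIn e R r
  gauss_P : IsGaussianMeasure P a S
  gauss_Q : IsGaussianMeasure Q b R

lemma exists_jointlyDiagonal [CompleteSpace X] {T S R : X →L[ℝ] X} {a b : X} {P Q : Measure X}
    (hT : T.IsPositive) (hP : IsNondegenerateGaussian P a S) (hQ : IsGaussianMeasure Q b R)
    (hTS : Commute T S) (hTR : Commute T R) (hSR : Commute S R) :
    ∃ (κ : Type u) (e : HilbertBasis κ ℝ X) (t s r : κ → ℝ),
      JointlyDiagonal e T S R t s r P Q a b := by
  obtain ⟨κ, e, c, hc⟩ := exists_hilbertBasis_joint_eigenvectors ![T, S, R]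
    (fun i => by
      fin_cases i
      · exact hT.isSymmetric
      · exact hP.1.cov_mem.1.isSymmetric
      · exact hQ.cov_mem.1.isSymmetric)
    (fun i j => by
      fin_cases i <;> fin_cases j
      exacts [.refl _, hTS, hTR, hTS.symm, .refl _, hSR, hTR.symm, hSR.symm, .refl _])
    1 hP.1.cov_mem.isCompactOperator hP.2
  exact ⟨κ, e, c 0, c 1, c 2, hc 0, hc 1, hc 2, hP.1, hQ⟩

namespace JointlyDiagonal

variable {e : HilbertBasis κ ℝ X} {T S R : X →L[ℝ] X} {t s r : κ → ℝ} {P Q : Measure X} {a b : X}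

lemma swap (h : JointlyDiagonal e T S R t s r P Q a b) :
    JointlyDiagonal e T R S t r s Q P b a :=
  ⟨h.diag_T, h.diag_R, h.diag_S, h.gauss_Q, h.gauss_P⟩

lemma self (h : JointlyDiagonal e T S R t s r P Q a b) :
    JointlyDiagonal e T S S t s s P P a a :=
  ⟨h.diag_T, h.diag_S, h.diag_S, h.gauss_P, h.gauss_P⟩

lemma nonneg (h : JointlyDiagonal e T S R t s r P Q a b) (i : κ) : 0 ≤ t i ^ 2 * s i :=
  mul_nonneg (sq_nonneg _) (h.gauss_P.entry_nonneg h.diag_S i)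

lemma nonneg' (h : JointlyDiagonal e T S R t s r P Q a b) (i : κ) : 0 ≤ t i ^ 2 * r i :=
  h.swap.nonneg i

lemma summable (h : JointlyDiagonal e T S R t s r P Q a b) : Summable fun i => t i ^ 2 * s i := by
  have hs := h.diag_S.summable_of_isPosTraceClass h.gauss_P.cov_mem
  refine Summable.of_nonneg_of_le h.nonneg (fun i => ?_) (hs.mul_left (‖T‖ ^ 2))
  refine mul_le_mul_of_nonneg_right ?_ (h.gauss_P.entry_nonneg h.diag_S i)
  exact sq_le_sq.2 ((h.diag_T.abs_entry_le i).trans (le_abs_self _))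

lemma summable_mul (h : JointlyDiagonal e T S R t s r P Q a b) :
    Summable fun i => (t i ^ 2 * s i) * (t i ^ 2 * r i) :=
  Summable.of_nonneg_of_le (fun i => mul_nonneg (h.nonneg i) (h.nonneg' i))
    (fun i => mul_le_mul_of_nonneg_right (h.summable.le_tsum i fun j _ => h.nonneg j) (h.nonneg' i))
    (h.swap.summable.mul_left (∑' i, t i ^ 2 * s i))

lemma inner_apply_sub (h : JointlyDiagonal e T S R t s r P Q a b) (i : κ) :
    ⟪e i, T (a - b)⟫ = t i * (⟪e i, a⟫ - ⟪e i, b⟫) := by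
  rw [h.diag_T.inner_apply, inner_sub_right]

lemma isDiagonalKernel (h : JointlyDiagonal e T S R t s r P Q a b) :
    IsDiagonalKernel e (fun i => t i ^ 2) (seKernel T) := by
  intro x y
  have h1 := (h.diag_T.hasSum_norm_apply_sq (x - y)).mul_left (-(1 / 2))
  convert! h1.rexp using 1
  · funext i
    simp only [Function.comp_apply, inner_sub_right]
  · rw [seKernel, map_sub]

lemma isDiagonalKernel_sq (h : JointlyDiagonal e T S R t s r P Q a b) :
    IsDiagonalKernel e (fun i => 2 * t i ^ 2) (fun x y => seKernel T x y ^ 2) := by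
  intro x y
  have h1 := (h.isDiagonalKernel x y).mul (h.isDiagonalKernel x y)
  convert! h1 using 1
  · funext i
    rw [← Real.exp_add]
    congr 1
    ring
  · ring

variable [CompleteSpace X] [TopologicalSpace.SeparableSpace X]

lemma kernelPair_eq (h : JointlyDiagonal e T S R t s r P Q a b) :
    kernelPair (seKernel T) P Q = opDet (1 + T * (S + R) * T) ^ (-(1 / 2) : ℝ) *
      Real.exp (-(1 / 2) * quadForm (opInv (1 + T * (S + R) * T)) (T (a - b))) := by
  have hM : DiagonalIn e (1 + T * (S + R) * T) (1 + fun i => t i ^ 2 * s i + t i ^ 2 * r i) := by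
    convert! DiagonalIn.one.add ((h.diag_T.mul (h.diag_S.add h.diag_R)).mul h.diag_T) using 1
    funext i
    simp only [Pi.add_apply, Pi.mul_apply, Pi.one_apply]
    ring
  have hN := hM.opInv fun i => by
    simp only [Pi.add_apply, Pi.one_apply]; linarith [h.nonneg i, h.nonneg' i]
  refine (h.isDiagonalKernel.hasProd_integral_integral (fun i => sq_nonneg _) h.gauss_P h.diag_S
    h.gauss_Q h.diag_R).unique ?_
  convert! hM.hasProd_gaussianForm (fun i => add_nonneg (h.nonneg i) (h.nonneg' i))
    (h.summable.add h.swap.summable) hN (T (a - b)) using 1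
  funext i
  simp only [h.inner_apply_sub, Pi.inv_apply, Pi.add_apply, Pi.one_apply]
  rw [← mul_add]
  congr 3
  ring

/-- Squaring the kernel doubles its diagonal entries, here `2 t²` in place of `t²`. -/
lemma kernelPair_sq_eq (h : JointlyDiagonal e T S R t s r P Q a b) :
    kernelPair (fun x y => seKernel T x y ^ 2) P Q =
      opDet (1 + (2 : ℝ) • (T * (S + R) * T)) ^ (-(1 / 2) : ℝ) *
      Real.exp (-quadForm (opInv (1 + (2 : ℝ) • (T * (S + R) * T))) (T (a - b))) := by
  have hM : DiagonalIn e (1 + (2 : ℝ) • (T * (S + R) * T))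
      (1 + fun i => 2 * (t i ^ 2 * s i + t i ^ 2 * r i)) := by
    convert! DiagonalIn.one.add
      (((h.diag_T.mul (h.diag_S.add h.diag_R)).mul h.diag_T).smul 2) using 1
    funext i
    simp only [Pi.add_apply, Pi.mul_apply, Pi.one_apply, Pi.smul_apply, smul_eq_mul]
    ring
  have hN := (hM.opInv fun i => by
    simp only [Pi.add_apply, Pi.one_apply]; linarith [h.nonneg i, h.nonneg' i]).smul 2
  have hF := hM.hasProd_gaussianForm (fun i => by linarith [h.nonneg i, h.nonneg' i])
    ((h.summable.add h.swap.summable).mul_left 2) hN (T (a - b))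
  have hE : -(1 / 2) * quadForm ((2 : ℝ) • opInv (1 + (2 : ℝ) • (T * (S + R) * T))) (T (a - b)) =
      -quadForm (opInv (1 + (2 : ℝ) • (T * (S + R) * T))) (T (a - b)) := by
    rw [quadForm_smul]; ring
  rw [hE] at hF
  refine (h.isDiagonalKernel_sq.hasProd_integral_integral (fun i => by positivity) h.gauss_P
    h.diag_S h.gauss_Q h.diag_R).unique ?_
  convert! hF using 1
  funext i
  simp only [h.inner_apply_sub, Pi.inv_apply, Pi.add_apply, Pi.one_apply, Pi.smul_apply,
    smul_eq_mul]
  rw [← mul_add, ← mul_assoc 2]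
  congr 3
  ring

lemma integral_meanEmb_mul_self (h : JointlyDiagonal e T S R t s r P Q a b) :
    ∫ x, meanEmb (seKernel T) P x * meanEmb (seKernel T) P x ∂P =
      opDet ((1 + T * S * T) * (1 + (3 : ℝ) • (T * S * T))) ^ (-(1 / 2) : ℝ) := by
  have hA := (h.diag_T.mul h.diag_S).mul h.diag_T
  have hM : DiagonalIn e ((1 + T * S * T) * (1 + (3 : ℝ) • (T * S * T)))
      (1 + fun i => 4 * (t i ^ 2 * s i) + 3 * ((t i ^ 2 * s i) * (t i ^ 2 * s i))) := by
    convert! (DiagonalIn.one.add hA).mul (DiagonalIn.one.add (hA.smul 3)) using 1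
    funext i
    simp only [Pi.add_apply, Pi.mul_apply, Pi.one_apply, Pi.smul_apply, smul_eq_mul]
    ring
  -- the three means agree, so the exponential is trivial: the quadratic form is evaluated at `0`
  have hF := hM.hasProd_gaussianForm
    (fun i => by have := h.nonneg i; positivity)
    ((h.summable.mul_left 4).add (h.self.summable_mul.mul_left 3)) hM 0
  rw [quadForm_zero, mul_zero, Real.exp_zero, mul_one] at hF
  refine (h.isDiagonalKernel.hasProd_integral_mul (fun i => sq_nonneg _) h.gauss_P h.diag_S
    h.gauss_P h.diag_S h.gauss_P h.diag_S).unique ?_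
  convert! hF using 1
  funext i
  have hD : (1 + t i ^ 2 * s i) * (1 + t i ^ 2 * s i) +
      t i ^ 2 * s i * (2 + t i ^ 2 * s i + t i ^ 2 * s i) =
      1 + (4 * (t i ^ 2 * s i) + 3 * ((t i ^ 2 * s i) * (t i ^ 2 * s i))) := by ring
  rw [hD]
  simp

omit [CompleteSpace X] [TopologicalSpace.SeparableSpace X] in
lemma diag_sigmaOp (h : JointlyDiagonal e T S R t s r P Q a b) :
    DiagonalIn e (sigmaOp T S R) (1 + fun i => 3 * (t i ^ 2 * s i) + t i ^ 2 * r i +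
      2 * ((t i ^ 2 * s i) * (t i ^ 2 * r i)) + (t i ^ 2 * s i) * (t i ^ 2 * s i)) := by
  have hA := (h.diag_T.mul h.diag_S).mul h.diag_T
  have hB := (h.diag_T.mul h.diag_R).mul h.diag_T
  have hC := (h.diag_T.mul (h.diag_S.add h.diag_R)).mul h.diag_T
  convert! ((DiagonalIn.one.add hA).mul (DiagonalIn.one.add hB)).add
    (hA.mul ((DiagonalIn.one.smul 2).add hC)) using 1
  funext i
  simp only [Pi.add_apply, Pi.mul_apply, Pi.one_apply, Pi.smul_apply, smul_eq_mul]
  ring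

lemma integral_meanEmb_mul (h : JointlyDiagonal e T S R t s r P Q a b) :
    ∫ x, meanEmb (seKernel T) P x * meanEmb (seKernel T) Q x ∂P =
      opDet (sigmaOp T S R) ^ (-(1 / 2) : ℝ) * Real.exp (-(1 / 2) *
          quadForm ((1 + (2 : ℝ) • (T * S * T)) * opInv (sigmaOp T S R)) (T (a - b))) := by
  have hA := (h.diag_T.mul h.diag_S).mul h.diag_T
  have hM := h.diag_sigmaOp
  have hN := (DiagonalIn.one.add (hA.smul 2)).mul (hM.opInv fun i => by
    simp only [Pi.add_apply, Pi.one_apply]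
    nlinarith [h.nonneg i, h.nonneg' i, mul_nonneg (h.nonneg i) (h.nonneg' i)])
  have hF := hM.hasProd_gaussianForm
    (fun i => by have := h.nonneg i; have := h.nonneg' i; positivity)
    ((((h.summable.mul_left 3).add h.swap.summable).add (h.summable_mul.mul_left 2)).add
      h.self.summable_mul) hN (T (a - b))
  refine (h.isDiagonalKernel.hasProd_integral_mul (fun i => sq_nonneg _) h.gauss_P h.diag_S
    h.gauss_P h.diag_S h.gauss_Q h.diag_R).unique ?_
  convert! hF using 1
  funext i
  have hD : (1 + t i ^ 2 * s i) * (1 + t i ^ 2 * r i) +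
      t i ^ 2 * s i * (2 + t i ^ 2 * s i + t i ^ 2 * r i) =
      1 + (3 * (t i ^ 2 * s i) + t i ^ 2 * r i +
      2 * ((t i ^ 2 * s i) * (t i ^ 2 * r i)) + (t i ^ 2 * s i) * (t i ^ 2 * s i)) := by ring
  rw [hD]
  simp only [h.inner_apply_sub, Pi.inv_apply, Pi.add_apply, Pi.one_apply, Pi.smul_apply,
    smul_eq_mul, Pi.mul_apply]
  congr 3
  ring

lemma integral_meanEmb_mul_other (h : JointlyDiagonal e T S R t s r P Q a b) :
    ∫ x, meanEmb (seKernel T) Q x * meanEmb (seKernel T) Q x ∂P =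
      opDet ((1 + T * R * T) * (1 + T * ((2 : ℝ) • S + R) * T)) ^ (-(1 / 2) : ℝ) *
        Real.exp (-quadForm (opInv (1 + T * ((2 : ℝ) • S + R) * T)) (T (a - b))) := by
  have hB := (h.diag_T.mul h.diag_R).mul h.diag_T
  have hC : DiagonalIn e (1 + T * ((2 : ℝ) • S + R) * T)
      (1 + fun i => 2 * (t i ^ 2 * s i) + t i ^ 2 * r i) := by
    convert! DiagonalIn.one.add ((h.diag_T.mul ((h.diag_S.smul 2).add h.diag_R)).mul h.diag_T)
      using 1
    funext i
    simp only [Pi.add_apply, Pi.mul_apply, Pi.one_apply, Pi.smul_apply, smul_eq_mul]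
    ring
  have hM : DiagonalIn e ((1 + T * R * T) * (1 + T * ((2 : ℝ) • S + R) * T))
      (1 + fun i => 2 * (t i ^ 2 * s i) + 2 * (t i ^ 2 * r i) +
        2 * ((t i ^ 2 * s i) * (t i ^ 2 * r i)) + (t i ^ 2 * r i) * (t i ^ 2 * r i)) := by
    convert! (DiagonalIn.one.add hB).mul hC using 1
    funext i
    simp only [Pi.add_apply, Pi.mul_apply, Pi.one_apply]
    ring
  have hN := (hC.opInv fun i => by
    simp only [Pi.add_apply, Pi.one_apply]; linarith [h.nonneg i, h.nonneg' i]).smul 2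
  have hF := hM.hasProd_gaussianForm
    (fun i => by have := h.nonneg i; have := h.nonneg' i; positivity)
    ((((h.summable.mul_left 2).add (h.swap.summable.mul_left 2)).add
      (h.summable_mul.mul_left 2)).add h.swap.self.summable_mul) hN (T (a - b))
  have hE : -(1 / 2) * quadForm ((2 : ℝ) • opInv (1 + T * ((2 : ℝ) • S + R) * T)) (T (a - b)) =
      -quadForm (opInv (1 + T * ((2 : ℝ) • S + R) * T)) (T (a - b)) := by
    rw [quadForm_smul]; ring
  rw [hE] at hF
  refine (h.isDiagonalKernel.hasProd_integral_mul (fun i => sq_nonneg _) h.gauss_P h.diag_S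
    h.gauss_Q h.diag_R h.gauss_Q h.diag_R).unique ?_
  convert! hF using 1
  funext i
  have hD : (1 + t i ^ 2 * r i) * (1 + t i ^ 2 * r i) +
      t i ^ 2 * s i * (2 + t i ^ 2 * r i + t i ^ 2 * r i) =
      1 + (2 * (t i ^ 2 * s i) + 2 * (t i ^ 2 * r i) +
        2 * ((t i ^ 2 * s i) * (t i ^ 2 * r i)) + (t i ^ 2 * r i) * (t i ^ 2 * r i)) := by ring
  have hD' : 1 + (2 * (t i ^ 2 * s i) + 2 * (t i ^ 2 * r i) +
        2 * ((t i ^ 2 * s i) * (t i ^ 2 * r i)) + (t i ^ 2 * r i) * (t i ^ 2 * r i)) =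
      (1 + t i ^ 2 * r i) * (1 + (2 * (t i ^ 2 * s i) + t i ^ 2 * r i)) := by ring
  rw [hD]
  congr 3
  have h1 : 0 < 1 + t i ^ 2 * r i := by linarith [h.nonneg' i]
  have h2 : 0 < 1 + (2 * (t i ^ 2 * s i) + t i ^ 2 * r i) := by linarith [h.nonneg i, h.nonneg' i]
  simp only [h.inner_apply_sub, Pi.inv_apply, Pi.add_apply, Pi.one_apply, Pi.smul_apply,
    smul_eq_mul]
  rw [hD']
  field_simp
  ring

lemma kernelPair_self_eq (h : JointlyDiagonal e T S R t s r P Q a b) :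
    kernelPair (seKernel T) P P = opDet (1 + (2 : ℝ) • (T * S * T)) ^ (-(1 / 2) : ℝ) := by
  have hTT : T * (S + S) * T = (2 : ℝ) • (T * S * T) := by
    rw [two_smul, mul_add, add_mul]
  rw [h.self.kernelPair_eq, sub_self, map_zero, quadForm_zero, mul_zero, Real.exp_zero, mul_one,
    hTT]

lemma kernelPair_sq_self_eq (h : JointlyDiagonal e T S R t s r P Q a b) :
    kernelPair (fun x y => seKernel T x y ^ 2) P P =
      opDet (1 + (4 : ℝ) • (T * S * T)) ^ (-(1 / 2) : ℝ) := by
  have hTT : (2 : ℝ) • (T * (S + S) * T) = (4 : ℝ) • (T * S * T) := by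
    rw [mul_add, add_mul, ← two_smul ℝ (T * S * T), smul_smul]
    norm_num
  rw [h.self.kernelPair_sq_eq, sub_self, map_zero, quadForm_zero, neg_zero, Real.exp_zero, mul_one,
    hTT]

omit [CompleteSpace X] [TopologicalSpace.SeparableSpace X] in
/-- The two determinants that enter `∫ μ_P dP` and `∫ μ_Q dP` are at least `1`, and multiplicative
in either order. -/
lemma opDet_mul (h : JointlyDiagonal e T S R t s r P Q a b) :
    1 ≤ opDet (1 + (2 : ℝ) • (T * S * T)) ∧ 1 ≤ opDet (1 + T * (S + R) * T) ∧
    opDet ((1 + (2 : ℝ) • (T * S * T)) * (1 + T * (S + R) * T)) =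
      opDet (1 + (2 : ℝ) • (T * S * T)) * opDet (1 + T * (S + R) * T) ∧
    opDet ((1 + T * (S + R) * T) * (1 + (2 : ℝ) • (T * S * T))) =
      opDet (1 + (2 : ℝ) • (T * S * T)) * opDet (1 + T * (S + R) * T) := by
  have hM : DiagonalIn e (1 + T * (S + R) * T) (1 + fun i => t i ^ 2 * s i + t i ^ 2 * r i) := by
    convert! DiagonalIn.one.add ((h.diag_T.mul (h.diag_S.add h.diag_R)).mul h.diag_T) using 1
    funext i
    simp only [Pi.add_apply, Pi.mul_apply, Pi.one_apply]
    ring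
  have hN : DiagonalIn e (1 + (2 : ℝ) • (T * S * T)) (1 + fun i => 2 * (t i ^ 2 * s i)) := by
    convert! DiagonalIn.one.add (((h.diag_T.mul h.diag_S).mul h.diag_T).smul 2) using 1
    funext i
    simp only [Pi.add_apply, Pi.mul_apply, Pi.one_apply, Pi.smul_apply, smul_eq_mul]
    ring
  have hc := fun i => add_nonneg (h.nonneg i) (h.nonneg' i)
  have hc' := fun i => mul_nonneg zero_le_two (h.nonneg i)
  have hs := h.summable.add h.swap.summable
  have hs' := h.summable.mul_left 2
  refine ⟨hN.one_le_opDet hc' hs', hM.one_le_opDet hc hs, hN.opDet_mul hc' hs' hM hc hs, ?_⟩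
  rw [hM.opDet_mul hc hs hN hc' hs', mul_comm]

end JointlyDiagonal

end

lemma rpow_neg_half_sq {x : ℝ} (hx : 0 ≤ x) : (x ^ (-(1 / 2) : ℝ)) ^ 2 = x⁻¹ := by
  rw [← Real.rpow_natCast, ← Real.rpow_mul hx, ← Real.rpow_neg_one]
  norm_num

lemma exp_neg_half_sq (x : ℝ) : Real.exp (-(1 / 2) * x) ^ 2 = Real.exp (-x) := by
  rw [← Real.exp_nat_mul]
  congr 1
  push_cast
  ring

section

variable {X : Type u} {κ : Type u} [NormedAddCommGroup X] [InnerProductSpace ℝ X]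

lemma alphaTerm_symm (T S R : X →L[ℝ] X) (a b : X) :
    alphaTerm T S R b a = alphaTerm T S R a b := by
  have : T (b - a) = -T (a - b) := by rw [← map_neg, neg_sub]
  simp only [alphaTerm, this, quadForm_neg]

lemma betaTerm_symm (T S R : X →L[ℝ] X) (a b : X) :
    betaTerm T S R b a = betaTerm T S R a b := by
  have : T (b - a) = -T (a - b) := by rw [← map_neg, neg_sub]
  simp only [betaTerm, this, quadForm_neg]

variable [MeasurableSpace X] [BorelSpace X] [CompleteSpace X] [TopologicalSpace.SeparableSpace X]

omit [CompleteSpace X] in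
lemma isBoundedKernel_seKernel (T : X →L[ℝ] X) : IsBoundedKernel (seKernel T) where
  measurable := by
    have : SecondCountableTopology X := UniformSpace.secondCountable_of_separable X
    refine Continuous.measurable ?_
    unfold Function.uncurry seKernel
    fun_prop
  abs_le_one x y := by
    rw [seKernel, abs_of_pos (Real.exp_pos _)]
    exact Real.exp_le_one_iff.2 (by nlinarith [sq_nonneg ‖T x - T y‖])
  symm x y := by
    rw [seKernel, seKernel, norm_sub_rev]

namespace JointlyDiagonal

variable {e : HilbertBasis κ ℝ X} {T S R : X →L[ℝ] X} {t s r : κ → ℝ} {P Q : Measure X} {a b : X}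

/-- `α(T, S, R, a, b)` is the variance under `P` of the witness function `μ_P - μ_Q`. -/
lemma alphaTerm_eq (h : JointlyDiagonal e T S R t s r P Q a b) :
    (∫ x, meanEmb (seKernel T) P x * meanEmb (seKernel T) P x ∂P)
      - 2 * (∫ x, meanEmb (seKernel T) P x * meanEmb (seKernel T) Q x ∂P)
      + (∫ x, meanEmb (seKernel T) Q x * meanEmb (seKernel T) Q x ∂P)
      - (kernelPair (seKernel T) P P - kernelPair (seKernel T) P Q) ^ 2 =
    alphaTerm T S R a b := by
  obtain ⟨h1, h2, h3, -⟩ := h.opDet_mul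
  have h1' := zero_le_one.trans h1
  have h2' := zero_le_one.trans h2
  rw [h.integral_meanEmb_mul_self, h.integral_meanEmb_mul, h.integral_meanEmb_mul_other,
    h.kernelPair_self_eq, h.kernelPair_eq, alphaTerm, h3, Real.mul_rpow h1' h2',
    ← rpow_neg_half_sq h1', ← rpow_neg_half_sq h2',
    ← exp_neg_half_sq (quadForm (opInv (1 + T * (S + R) * T)) (T (a - b)))]
  ring

/-- `β(T, S, R, a, b)` collects `Var k(x, x')`, half of `Var k(x, y') + Var k(x', y)`, and the
covariances of `k(x, x')` with `k(x, y')` and `k(x', y)`. -/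
lemma betaTerm_eq (h : JointlyDiagonal e T S R t s r P Q a b) :
    kernelPair (fun x y => seKernel T x y ^ 2) P P - kernelPair (seKernel T) P P ^ 2
      + (kernelPair (fun x y => seKernel T x y ^ 2) P Q - kernelPair (seKernel T) P Q ^ 2)
      - 4 * ((∫ x, meanEmb (seKernel T) P x * meanEmb (seKernel T) Q x ∂P)
        - kernelPair (seKernel T) P P * kernelPair (seKernel T) P Q) =
    betaTerm T S R a b := by
  obtain ⟨h1, h2, -, h3⟩ := h.opDet_mul
  have h1' := zero_le_one.trans h1
  have h2' := zero_le_one.trans h2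
  rw [h.integral_meanEmb_mul, h.kernelPair_sq_self_eq, h.kernelPair_sq_eq,
    h.kernelPair_self_eq, h.kernelPair_eq, betaTerm, h3, Real.mul_rpow h1' h2',
    ← rpow_neg_half_sq h1', ← rpow_neg_half_sq h2',
    ← exp_neg_half_sq (quadForm (opInv (1 + T * (S + R) * T)) (T (a - b)))]
  ring

lemma xiOne_eq (h : JointlyDiagonal e T S R t s r P Q a b) :
    xiOne (seKernel T) P Q = alphaTerm T S R a b + alphaTerm T R S a b := by
  have := h.gauss_P.gaussian
  have := h.gauss_Q.gaussian
  have hk := isBoundedKernel_seKernel T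
  rw [GaussianMMD.xiOne_eq hk, ← alphaTerm_symm T R S, ← h.alphaTerm_eq, ← h.swap.alphaTerm_eq,
    hk.kernelPair_comm (P := P) (Q := Q)]

lemma xiTwo_eq (h : JointlyDiagonal e T S R t s r P Q a b) :
    xiTwo (seKernel T) P Q = betaTerm T S R a b + betaTerm T R S a b := by
  have := h.gauss_P.gaussian
  have := h.gauss_Q.gaussian
  have hk := isBoundedKernel_seKernel T
  have hsq : kernelPair (fun x y => seKernel T x y ^ 2) Q P =
      kernelPair (fun x y => seKernel T x y ^ 2) P Q := by
    rw [h.kernelPair_sq_eq, h.swap.kernelPair_sq_eq, add_comm R S,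
      show T (b - a) = -T (a - b) by rw [← map_neg, neg_sub], quadForm_neg]
  rw [GaussianMMD.xiTwo_eq hk, ← betaTerm_symm T R S, ← h.betaTerm_eq, ← h.swap.betaTerm_eq,
    hk.kernelPair_comm (P := P) (Q := Q), hsq]
  ring

end JointlyDiagonal

end

end GaussianMMD

end

theorem theorem5p7 {X : Type*} [NormedAddCommGroup X] [InnerProductSpace ℝ X] [CompleteSpace X]
    [TopologicalSpace.SeparableSpace X] [MeasurableSpace X] [BorelSpace X] :
    (∀ (T S : X →L[ℝ] X) (m : X) (P Q : Measure X),
      GaussianMMD.IsPosTraceClass T →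
      GaussianMMD.IsNondegenerateGaussian P 0 S →
      GaussianMMD.IsNondegenerateGaussian Q m S →
      Commute T S →
      GaussianMMD.xiOne (GaussianMMD.seKernel T) P Q =
        2 * GaussianMMD.opDet ((1 + T * S * T) * (1 + (3 : ℝ) • (T * S * T))) ^ (-(1 / 2) : ℝ)
          * (1 + Real.exp (-GaussianMMD.quadForm
                (GaussianMMD.opInv (1 + (3 : ℝ) • (T * S * T))) (T m))
              - 2 * Real.exp (-(1 / 2) * GaussianMMD.quadForm
                ((1 + (2 : ℝ) • (T * S * T)) *
                  GaussianMMD.opInv ((1 + T * S * T) * (1 + (3 : ℝ) • (T * S * T)))) (T m)))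
        - 2 * (GaussianMMD.opDet (1 + (2 : ℝ) • (T * S * T)))⁻¹
          * (1 + Real.exp (-GaussianMMD.quadForm
                (GaussianMMD.opInv (1 + (2 : ℝ) • (T * S * T))) (T m))
              - 2 * Real.exp (-(1 / 2) * GaussianMMD.quadForm
                (GaussianMMD.opInv (1 + (2 : ℝ) • (T * S * T))) (T m))) ∧
      GaussianMMD.xiTwo (GaussianMMD.seKernel T) P Q =
        2 * GaussianMMD.opDet (1 + (4 : ℝ) • (T * S * T)) ^ (-(1 / 2) : ℝ)
          * (1 + Real.exp (-GaussianMMD.quadForm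
                (GaussianMMD.opInv (1 + (4 : ℝ) • (T * S * T))) (T m)))
        - 2 * (GaussianMMD.opDet (1 + (2 : ℝ) • (T * S * T)))⁻¹
          * (1 + Real.exp (-GaussianMMD.quadForm
                (GaussianMMD.opInv (1 + (2 : ℝ) • (T * S * T))) (T m))
              - 4 * Real.exp (-(1 / 2) * GaussianMMD.quadForm
                (GaussianMMD.opInv (1 + (2 : ℝ) • (T * S * T))) (T m)))
        - 8 * GaussianMMD.opDet ((1 + T * S * T) * (1 + (3 : ℝ) • (T * S * T))) ^ (-(1 / 2) : ℝ)
          * Real.exp (-(1 / 2) * GaussianMMD.quadForm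
              ((1 + (2 : ℝ) • (T * S * T)) *
                GaussianMMD.opInv ((1 + T * S * T) * (1 + (3 : ℝ) • (T * S * T)))) (T m))) ∧
    (∀ (T S R : X →L[ℝ] X) (a b : X) (P Q : Measure X),
      T.IsPositive →
      GaussianMMD.IsNondegenerateGaussian P a S →
      GaussianMMD.IsNondegenerateGaussian Q b R →
      Commute T S → Commute T R → Commute S R →
      GaussianMMD.xiOne (GaussianMMD.seKernel T) P Q =
        GaussianMMD.alphaTerm T S R a b + GaussianMMD.alphaTerm T R S a b ∧
      GaussianMMD.xiTwo (GaussianMMD.seKernel T) P Q =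
        GaussianMMD.betaTerm T S R a b + GaussianMMD.betaTerm T R S a b) := by
  constructor
  · intro T S m P Q hT hP hQ hTS
    obtain ⟨κ, e, t, s, r, h⟩ :=
      GaussianMMD.exists_jointlyDiagonal hT.1 hP hQ.1 hTS hTS (.refl S)
    have hd : T (0 - m) = -T m := by rw [zero_sub, map_neg]
    have h2 : T * (S + S) * T = (2 : ℝ) • (T * S * T) := by
      rw [two_smul, mul_add, add_mul]
    have h3 : T * ((2 : ℝ) • S + S) * T = (3 : ℝ) • (T * S * T) := by
      rw [mul_add, add_mul, mul_smul_comm, smul_mul_assoc]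
      module
    have h4 : (2 : ℝ) • (T * (S + S) * T) = (4 : ℝ) • (T * S * T) := by
      rw [h2, smul_smul]
      norm_num
    have hσ : GaussianMMD.sigmaOp T S S = (1 + T * S * T) * (1 + (3 : ℝ) • (T * S * T)) := by
      rw [GaussianMMD.sigmaOp, h2]
      simp only [mul_add, add_mul, mul_one, one_mul, mul_smul_comm]
      module
    obtain ⟨h1, -, hdet, -⟩ := h.opDet_mul
    have h1' := zero_le_one.trans h1
    -- `det((1 + 2TST)²)^(-1/2) = det(1 + 2TST)⁻¹`
    have hsq : GaussianMMD.opDet ((1 + (2 : ℝ) • (T * S * T)) * (1 + (2 : ℝ) • (T * S * T)))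
        ^ (-(1 / 2) : ℝ) = (GaussianMMD.opDet (1 + (2 : ℝ) • (T * S * T)))⁻¹ := by
      rw [h2] at hdet
      rw [hdet, Real.mul_rpow h1' h1', ← sq, GaussianMMD.rpow_neg_half_sq h1']
    constructor
    · rw [h.xiOne_eq, GaussianMMD.alphaTerm]
      simp only [hd, GaussianMMD.quadForm_neg, h2, h3, hσ, hsq]
      ring
    · rw [h.xiTwo_eq, GaussianMMD.betaTerm]
      simp only [h4]
      simp only [hd, GaussianMMD.quadForm_neg, h2, hσ, hsq]
      ring
  · intro T S R a b P Q hT hP hQ hTS hTR hSR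
    obtain ⟨κ, e, t, s, r, h⟩ := GaussianMMD.exists_jointlyDiagonal hT hP hQ.1 hTS hTR hSR
    exact ⟨h.xiOne_eq, h.xiTwo_eq⟩
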